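/- Consider the planar system $\dot\alpha=\omega(A)+\varepsilon F(\alpha,A,t)$, $\dot A=\varepsilon G(\alpha,A,t)$ on $\mathbb T\times W$, where $\mathbb T=\mathbb R/2\pi\mathbb Z$, $W\subset\mathbb R$ is open, $\omega$ is real analytic on $W$, $F$ and $G$ are real analytic on $\mathbb R\times W\times\mathbb R$ and $2\pi$-periodic in $\alpha$ and in $t$, and $\varepsilon$ is a real parameter. Let $A_0\in W$ satisfy $\omega(A_0)=p/q$, with $p\in\mathbb Z$ and $q\ge1$ coprime, and $\omega'(A_0)\ne0$. Put $T=2\pi q$ and let $$M(t_0)=\frac1T\int_0^T G(\omega(A_0)t,A_0,t+t_0)\,dt$$ be the subharmonic Melnikov function. Suppose that $t_0$ is a zero of $M$ of odd order $n$, that is, $M^{(k)}(t_0)=0$ for $0\le k\le n-1$ and $M^{(n)}(t_0)\neq0$. Then for all sufficiently small $|\varepsilon|$ the system has at least one subharmonic solution of order $q/p$ continuing the unperturbed trajectory with initial phase $t_0$, and it admits a convergent power series in $|\varepsilon|^{1/n!}$ (hence a convergent Puiseux series in $|\varepsilon|$), in general with different coefficients for $\varepsilon>0$ and for $\varepsilon<0$.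 In detail: there exist $\varepsilon_0>0$ and, for $|\varepsilon|<\varepsilon_0$, functions $\alpha_\varepsilon:\mathbb R\to\mathbb R$ and $A_\varepsilon:\mathbb R\to W$ such that 1. $\dot\alpha_\varepsilon(t)=\omega(A_\varepsilon(t))+\varepsilon F(\alpha_\varepsilon(t),A_\varepsilon(t),t+t_0)$ and $\dot A_\varepsilon(t)=\varepsilon G(\alpha_\varepsilon(t),A_\varepsilon(t),t+t_0)$ for all $t\in\mathbb R$, i.e. $t\mapsto(\alpha_\varepsilon(t),A_\varepsilon(t),t+t_0)$ is a trajectory of the system in the extended phase space; 2. $\alpha_\varepsilon(t+T)=\alpha_\varepsilon(t)+2\pi p$ and $A_\varepsilon(t+T)=A_\varepsilon(t)$ for all $t$; 3. $\alpha_\varepsilon(t)\to\omega(A_0)t$ and $A_\varepsilon(t)\to A_0$ uniformly in $t$ as $\varepsilon\to0$; 4. for each sign $\sigma=\pm1$ there are $T$-periodic functions $\beta^{[k]},B^{[k]}:\mathbb R\to\mathbb R$, $k\ge1$, such that $$\alpha_\varepsilon(t)=\omega(A_0)t+\sum_{k\ge1}|\varepsilon|^{k/n!}\beta^{[k]}(t),\qquad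 A_\varepsilon(t)=A_0+\sum_{k\ge1}|\varepsilon|^{k/n!}B^{[k]}(t)$$ for all $t\in\mathbb R$ and all $\varepsilon$ with $|\varepsilon|<\varepsilon_0$ and $\sigma\varepsilon\ge0$, where each of the two series converges uniformly in $t$, with bounds $|\beta^{[k]}(t)|\le C r^{-k}$ and $|B^{[k]}(t)|\le C' r'^{-k}$ for all $k$ and $t$, for some constants $C,C'$ and some $r,r'>0$ larger than every $|\varepsilon|^{1/n!}$ occurring. -/

import Mathlib

open Filter Topology

/-- The data of the planar system `α' = ω(A) + ε F(α, A, t)`, `A' = ε G(α, A, t)` on `𝕋 × W`: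
`W ⊆ ℝ` is open, `ω` is real analytic on `W`, and `F`, `G` are (jointly) real analytic on
`ℝ × W × ℝ` and `2π`-periodic in `α` and in `t`. The angle `α` is lifted to `ℝ`. -/
structure PlanarSystem where
  W : Set ℝ
  isOpen_W : IsOpen W
  ω : ℝ → ℝ
  F : ℝ → ℝ → ℝ → ℝ
  G : ℝ → ℝ → ℝ → ℝ
  analytic_ω : AnalyticOnNhd ℝ ω W
  analytic_F : AnalyticOnNhd ℝ (fun x : ℝ × ℝ × ℝ => F x.1 x.2.1 x.2.2) {x | x.2.1 ∈ W}
  analytic_G : AnalyticOnNhd ℝ (fun x : ℝ × ℝ × ℝ => G x.1 x.2.1 x.2.2) {x | x.2.1 ∈ W}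
  periodic_F_angle : ∀ α t : ℝ, ∀ A ∈ W, F (α + 2 * Real.pi) A t = F α A t
  periodic_F_time : ∀ α t : ℝ, ∀ A ∈ W, F α A (t + 2 * Real.pi) = F α A t
  periodic_G_angle : ∀ α t : ℝ, ∀ A ∈ W, G (α + 2 * Real.pi) A t = G α A t
  periodic_G_time : ∀ α t : ℝ, ∀ A ∈ W, G α A (t + 2 * Real.pi) = G α A t

namespace PlanarSystem

/-- `(α(t), A(t), t + t₀)` is a trajectory, defined for all times, of the system with perturbation
parameter `ε` in the extended phase space. Equivalently, `(α(t - t₀), A(t - t₀))` solves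
`α' = ω(A) + ε F(α, A, t)`, `A' = ε G(α, A, t)`. -/
def IsSolution (S : PlanarSystem) (ε t₀ : ℝ) (α A : ℝ → ℝ) : Prop :=
  ∀ t : ℝ, A t ∈ S.W ∧
    HasDerivAt α (S.ω (A t) + ε * S.F (α t) (A t) (t + t₀)) t ∧
    HasDerivAt A (ε * S.G (α t) (A t) (t + t₀)) t

/-- The subharmonic Melnikov function
`M(t₀) = (1/T) ∫₀ᵀ G(ω(A₀) t, A₀, t + t₀) dt`, with `T = 2πq`. -/
noncomputable def melnikov (S : PlanarSystem) (A₀ : ℝ) (q : ℕ) (t₀ : ℝ) : ℝ :=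
  1 / (2 * Real.pi * q) *
    ∫ t in (0 : ℝ)..(2 * Real.pi * q), S.G (S.ω A₀ * t) A₀ (t + t₀)

/-- `(α ε, A ε)`, `|ε| < ε₀`, are subharmonic solutions of order `q/p` continuing the unperturbed
periodic trajectory `(ω(A₀) t, A₀, t + t₀)`: they are solutions, periodic with period `2πq` on
`𝕋 × W` and with `α` making `p` turns in a period (for coprime `p`, `q`, the number `2πq` is then
the least period in the extended phase space), and they tend to the unperturbed
solution as `ε → 0`. -/
structure IsSubharmonic (S : PlanarSystem) (A₀ : ℝ) (p : ℤ) (q : ℕ) (t₀ ε₀ : ℝ)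
    (α A : ℝ → ℝ → ℝ) : Prop where
  isSolution : ∀ ε : ℝ, |ε| < ε₀ → S.IsSolution ε t₀ (α ε) (A ε)
  angle_periodic : ∀ ε : ℝ, |ε| < ε₀ → ∀ t : ℝ,
    α ε (t + 2 * Real.pi * q) = α ε t + 2 * Real.pi * p
  action_periodic : ∀ ε : ℝ, |ε| < ε₀ → ∀ t : ℝ, A ε (t + 2 * Real.pi * q) = A ε t
  tendsto_angle : TendstoUniformly α (fun t => S.ω A₀ * t) (𝓝 0)
  tendsto_action : TendstoUniformly A (fun _ => A₀) (𝓝 0)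

end PlanarSystem

/-- `t₀` is a zero of order `n` of the smooth function `M`. -/
def IsZeroOfOrder (M : ℝ → ℝ) (n : ℕ) (t₀ : ℝ) : Prop :=
  (∀ k < n, iteratedDeriv k M t₀ = 0) ∧ iteratedDeriv n M t₀ ≠ 0

/-- For `ε` in `s`, the function `u ε` is the sum of a power series in `|ε|^{1/N}` without constant
term, whose coefficients are `T`-periodic functions of time, and which is convergent: the
coefficients are bounded, uniformly in time, by `C r⁻ᵏ`, where `r` exceeds all the values
`|ε|^{1/N}`, `ε ∈ s`. -/
def HasFractionalExpansion (N : ℕ) (T : ℝ) (s : Set ℝ) (u : ℝ → ℝ → ℝ) : Prop :=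
  ∃ c : ℕ → ℝ → ℝ,
    (∀ k t, c k (t + T) = c k t) ∧
    (∀ t, c 0 t = 0) ∧
    (∃ r C : ℝ, 0 < r ∧ (∀ ε ∈ s, |ε| ^ (1 / (N : ℝ)) < r) ∧ ∀ k t, |c k t| * r ^ k ≤ C) ∧
    ∀ ε ∈ s, ∀ t, HasSum (fun k => c k t * (|ε| ^ (1 / (N : ℝ))) ^ k) (u ε t)

/-!
The subharmonic solutions are obtained by a Lyapunov–Schmidt reduction followed by a real version of
Puiseux's theorem; both are carried out directly with convergent power series.

*Reduction.* On the Banach space `C([0, T])` the superposition operators `u ↦ g ∘ u` of analytic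
functions `g` are analytic (`analyticAt_superposition`): the Taylor coefficients of `g` are bounded
uniformly on compact sets. Write `α = ω(A₀) t + x`, `A = A₀ + y`. Since `ω'(A₀) ≠ 0`, the analytic
implicit function theorem solves the integrated equations of motion together with the condition
`α(T) = α(0) + 2πp`, as functions `(x, y) = ψ (b, ε)` of the initial deviation `b` of the angle and
of `ε` (`PlanarSystem.exists_reduction`). The remaining condition `A(T) = A(0)`, divided by `ε`, is
a scalar equation `h (b, ε) = 0` with `h` analytic, and `h (b, 0) = T M(t₀ - b / ω(A₀))`
(`PlanarSystem.integral_eq_melnikov`), which has a zero of order `n` at `b = 0`. Here `ω(A₀) ≠ 0`,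
because otherwise `M` would be constant.

*Branches.* If `h (·, 0)` has a zero of odd order `n`, then `h (b, e) = 0` has a real branch `b`
which is an analytic function of `e ^ (1 / n!)` (`exists_puiseux_branch`). A translation removes the
coefficient of `b ^ (n - 1)`; then the substitution `e = s ^ m`, `b = s ^ k c` given by the first
side of the Newton polygon turns the equation at `s = 0` into a polynomial equation of odd degree
`n` for `c`, which is not an `n`-th power of a linear factor. It therefore has a real root of
smaller odd order `k'`, and it can be chosen with `m * k'! ∣ n!`, so that the denominators
accumulated in the induction divide `n!` (`Polynomial.exists_odd_order_root`).

*Conclusion.* Apply this to `h (b, σ e)` for `σ = ±1`. Composed with `ψ`, each branch is an analytic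
curve in `C([0, T])²`, whose power series in `s = |ε| ^ (1 / n!)` has coefficients bounded uniformly
in time. The solutions on `[0, T]` close up, hence extend periodically to solutions on `ℝ`.
-/

/-! ### Superposition operators on spaces of continuous functions -/

section Superposition

open scoped ENNReal NNReal ContDiff

variable {V W : Type*} [NormedAddCommGroup V] [NormedSpace ℝ V] [NormedAddCommGroup W]
  [NormedSpace ℝ W]

/-- The Taylor coefficient of order `n` of `f` at `x`, as a multilinear map. -/
noncomputable def taylorCoeff (f : V → W) (n : ℕ) (x : V) :
    ContinuousMultilinearMap ℝ (fun _ : Fin n => V) W :=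
  (n.factorial : ℝ)⁻¹ • iteratedFDeriv ℝ n f x

theorem norm_taylorCoeff_le [CompleteSpace W] {f : V → W} {p : FormalMultilinearSeries ℝ V W}
    {x : V} {r : ℝ≥0∞} (h : HasFPowerSeriesOnBall f p x r) (n : ℕ) : ‖taylorCoeff f n x‖ ≤ ‖p n‖ := by
  refine ContinuousMultilinearMap.opNorm_le_bound (norm_nonneg _) fun v => ?_
  have hn : (0 : ℝ) < n.factorial := by exact_mod_cast n.factorial_pos
  rw [taylorCoeff, smul_apply, norm_smul,
    h.iteratedFDeriv_eq_sum_of_completeSpace, norm_inv, Real.norm_of_nonneg hn.le,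
    inv_mul_le_iff₀ hn]
  refine (norm_sum_le _ _).trans ?_
  refine (Finset.sum_le_sum (g := fun _ => ‖p n‖ * ∏ i, ‖v i‖) fun σ _ => ?_).trans ?_
  · refine ((p n).le_opNorm _).trans (le_of_eq ?_)
    rw [Equiv.prod_comp σ (fun i => ‖v i‖)]
  · simp [Fintype.card_perm]

/-- The Taylor expansions of an analytic function at nearby points have a common lower bound for
the radius of convergence, and a common bound for the coefficients. -/
theorem AnalyticAt.exists_uniform_taylor [CompleteSpace W] {f : V → W} {x : V} (hf : AnalyticAt ℝ f x) :
    ∃ ρ > (0 : ℝ), ∃ C : ℝ, ∀ᶠ y in 𝓝 x, (∀ n, ‖taylorCoeff f n y‖ * ρ ^ n ≤ C) ∧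
      ∀ w : V, ‖w‖ < ρ → HasSum (fun n => taylorCoeff f n y (fun _ => w)) (f (y + w)) := by
  obtain ⟨p, r, hp⟩ := hf
  obtain ⟨ρ, hρ0, hρ⟩ : ∃ ρ : ℝ≥0, 0 < ρ ∧ (ρ + ρ : ℝ≥0∞) < r := by
    obtain ⟨a, ha0, ha⟩ := ENNReal.lt_iff_exists_nnreal_btwn.1 hp.r_pos
    refine ⟨a / 2, by simpa using ha0, ?_⟩
    rw [← ENNReal.coe_add, add_halves]
    exact ha
  have hS := p.changeOriginSeries_summable_aux₁ (hρ.trans_le hp.r_le)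
  have hS2 := NNReal.summable_sigma.1 hS
  refine ⟨ρ, hρ0, ((∑' k : ℕ, ∑' s : Σ l : ℕ, { s : Finset (Fin (k + l)) // s.card = l },
    ‖p (k + s.1)‖₊ * ρ ^ s.1 * ρ ^ k : ℝ≥0) : ℝ), ?_⟩
  filter_upwards [Metric.ball_mem_nhds x (show (0 : ℝ) < ρ from hρ0)] with y hy
  have hy' : ‖y - x‖₊ < ρ := by
    rw [mem_ball_iff_norm] at hy
    exact hy
  have hyr : (‖y - x‖₊ : ℝ≥0∞) < r :=
    (ENNReal.coe_lt_coe.2 hy').trans (lt_of_le_of_lt le_self_add hρ)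
  have hq := hp.changeOrigin hyr
  rw [add_sub_cancel] at hq
  have hle : (ρ : ℝ≥0∞) ≤ r - ‖y - x‖₊ := by
    refine ENNReal.le_sub_of_add_le_left ENNReal.coe_ne_top ?_
    refine le_trans ?_ hρ.le
    gcongr
  refine ⟨fun n => ?_, fun w hw => ?_⟩
  · refine (mul_le_mul_of_nonneg_right (norm_taylorCoeff_le hq n) (by positivity)).trans ?_
    have h1 : ‖p.changeOrigin (y - x) n‖₊ * ρ ^ n ≤
        ∑' s : Σ l : ℕ, { s : Finset (Fin (n + l)) // s.card = l },
          ‖p (n + s.1)‖₊ * ρ ^ s.1 * ρ ^ n := by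
      rw [NNReal.tsum_mul_right]
      refine mul_le_mul_left ((p.nnnorm_changeOrigin_le n (hyr.trans_le hp.r_le)).trans ?_) _
      refine Summable.tsum_le_tsum (fun s => by gcongr)
        (p.changeOriginSeries_summable_aux₂ (hyr.trans_le hp.r_le) n)
        (p.changeOriginSeries_summable_aux₂
          ((lt_of_le_of_lt le_self_add hρ).trans_le hp.r_le) n)
    have h2 := h1.trans (hS2.2.le_tsum' n)
    exact_mod_cast h2
  · have := hq.hasSum_iteratedFDeriv (y := w) (by
      rw [mem_eball_zero_iff]
      refine lt_of_lt_of_le ?_ hle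
      exact ENNReal.coe_lt_coe.2 hw)
    simpa [taylorCoeff] using this

theorem AnalyticOnNhd.exists_uniform_taylor [CompleteSpace W] {f : V → W} {s : Set V}
    (hs : IsCompact s)
    (hf : AnalyticOnNhd ℝ f s) :
    ∃ ρ > (0 : ℝ), ∃ C : ℝ, ∀ y ∈ s, (∀ n, ‖taylorCoeff f n y‖ * ρ ^ n ≤ C) ∧
      ∀ w : V, ‖w‖ < ρ → HasSum (fun n => taylorCoeff f n y (fun _ => w)) (f (y + w)) := by
  refine hs.induction_on (p := fun s => ∃ ρ > (0 : ℝ), ∃ C : ℝ, ∀ y ∈ s,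
      (∀ n, ‖taylorCoeff f n y‖ * ρ ^ n ≤ C) ∧
      ∀ w : V, ‖w‖ < ρ → HasSum (fun n => taylorCoeff f n y (fun _ => w)) (f (y + w)))
    ⟨1, one_pos, 0, by simp⟩ ?_ ?_ ?_
  · rintro s t hst ⟨ρ, h0, C, h⟩
    exact ⟨ρ, h0, C, fun y hy => h y (hst hy)⟩
  · rintro s t ⟨ρ, h0, C, h⟩ ⟨ρ', h0', C', h'⟩
    refine ⟨min ρ ρ', lt_min h0 h0', max C C', ?_⟩
    rintro y (hy | hy)
    · refine ⟨fun n => le_trans ?_ (((h y hy).1 n).trans (le_max_left _ _)),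
        fun w hw => (h y hy).2 w (hw.trans_le (min_le_left _ _))⟩
      gcongr
      exact min_le_left _ _
    · refine ⟨fun n => le_trans ?_ (((h' y hy).1 n).trans (le_max_right _ _)),
        fun w hw => (h' y hy).2 w (hw.trans_le (min_le_right _ _))⟩
      gcongr
      exact min_le_right _ _
  · intro x hx
    obtain ⟨ρ, h0, C, h⟩ := (hf x hx).exists_uniform_taylor
    exact ⟨_, mem_nhdsWithin_of_mem_nhds h, ρ, h0, C, fun y hy => hy⟩

variable {K : Type*} [TopologicalSpace K] [CompactSpace K]

/-- Pointwise application of a continuous family of multilinear maps, as a multilinear map on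
spaces of continuous functions. -/
noncomputable def pointwiseMultilinear {n : ℕ}
    (q : C(K, ContinuousMultilinearMap ℝ (fun _ : Fin n => V) W)) :
    ContinuousMultilinearMap ℝ (fun _ : Fin n => C(K, V)) C(K, W) :=
  MultilinearMap.mkContinuous
    { toFun := fun u => ⟨fun k => q k (fun i => u i k), by fun_prop⟩
      map_update_add' := by
        intro _ m i x y
        ext k
        have h : ∀ z : C(K, V), (fun j => (Function.update m i z) j k) =
            Function.update (fun j => m j k) i (z k) := fun z => by
          ext j
          by_cases hj : j = i
          · subst hj; simp
          · simp [hj]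
        simp [h]
      map_update_smul' := by
        intro _ m i c x
        ext k
        have h : ∀ z : C(K, V), (fun j => (Function.update m i z) j k) =
            Function.update (fun j => m j k) i (z k) := fun z => by
          ext j
          by_cases hj : j = i
          · subst hj; simp
          · simp [hj]
        simp [h] }
    ‖q‖ (fun u => by
      refine (ContinuousMap.norm_le _ (by positivity)).2 fun k => ?_
      refine ((q k).le_opNorm _).trans ?_
      refine mul_le_mul (q.norm_coe_le_norm k) ?_ (by positivity) (by positivity)
      exact Finset.prod_le_prod (fun i _ => norm_nonneg _) fun i _ => (u i).norm_coe_le_norm k)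

theorem norm_pointwiseMultilinear_le {n : ℕ}
    (q : C(K, ContinuousMultilinearMap ℝ (fun _ : Fin n => V) W)) :
    ‖pointwiseMultilinear q‖ ≤ ‖q‖ :=
  MultilinearMap.mkContinuous_norm_le (C := ‖q‖) _ (norm_nonneg q) _

open Classical in
/-- The superposition (Nemytskii) operator `u ↦ f ∘ u` on continuous functions, with the junk value
`0` where `f ∘ u` is not continuous. -/
noncomputable def superposition (f : V → W) (u : C(K, V)) : C(K, W) :=
  if h : Continuous (f ∘ u) then ⟨f ∘ u, h⟩ else 0

theorem superposition_apply {V W K : Type*} [NormedAddCommGroup V] [NormedAddCommGroup W]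
    [TopologicalSpace K] {f : V → W} {u : C(K, V)} (h : ∀ k, ContinuousAt f (u k)) (k : K) :
    superposition f u k = f (u k) := by
  have : Continuous (f ∘ u) := continuous_iff_continuousAt.2 fun k =>
    ContinuousAt.comp (h k) u.continuous.continuousAt
  rw [superposition, dif_pos this]
  rfl

/-- The superposition operator of an analytic function is analytic: its Taylor coefficients act
pointwise through those of `f`, which are bounded uniformly on the compact range of `u₀`. -/
theorem analyticAt_superposition [CompleteSpace W] {f : V → W} {u₀ : C(K, V)}
    (hf : ∀ k, AnalyticAt ℝ f (u₀ k)) :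
    AnalyticAt ℝ (superposition (K := K) f) u₀ := by
  have hcpt : IsCompact (Set.range u₀) := isCompact_range u₀.continuous
  have hf' : AnalyticOnNhd ℝ f (Set.range u₀) := by
    rintro _ ⟨k, rfl⟩
    exact hf k
  obtain ⟨ρ₁, hρ₁, C, hC⟩ := hf'.exists_uniform_taylor hcpt
  -- functions close to `u₀` stay in the open set where `f` is analytic
  obtain ⟨ρ₂, hρ₂, hball⟩ := hcpt.exists_thickening_subset_open (isOpen_analyticAt ℝ f)
    (show Set.range u₀ ⊆ {x | AnalyticAt ℝ f x} from hf')
  set ρ : ℝ := min ρ₁ ρ₂ with hρdef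
  have hρ : 0 < ρ := lt_min hρ₁ hρ₂
  have hcont : ∀ n, Continuous fun k => taylorCoeff f n (u₀ k) := fun n => by
    refine continuous_iff_continuousAt.2 fun k => ?_
    have h1 : ContinuousAt (iteratedFDeriv ℝ n f) (u₀ k) :=
      (AnalyticOnNhd.iteratedFDeriv (s := {x | AnalyticAt ℝ f x}) (fun _ hx => hx) n _
        (hf k)).continuousAt
    exact ContinuousAt.comp (g := taylorCoeff f n) (h1.const_smul (n.factorial : ℝ)⁻¹)
      u₀.continuous.continuousAt
  let q : ∀ n, C(K, ContinuousMultilinearMap ℝ (fun _ : Fin n => V) W) := fun n => ⟨_, hcont n⟩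
  have hC0 : 0 ≤ |C| := abs_nonneg C
  have hq : ∀ n, ‖q n‖ * ρ ^ n ≤ |C| := fun n => by
    rw [← le_div_iff₀ (by positivity)]
    refine (ContinuousMap.norm_le _ (by positivity)).2 fun k => ?_
    rw [le_div_iff₀ (by positivity)]
    refine le_trans ?_ (((hC _ ⟨k, rfl⟩).1 n).trans (le_abs_self C))
    have : ρ ≤ ρ₁ := min_le_left _ _
    have h3 : ρ ^ n ≤ ρ₁ ^ n := by gcongr
    exact mul_le_mul_of_nonneg_left h3 (norm_nonneg _)
  let P : FormalMultilinearSeries ℝ C(K, V) C(K, W) := fun n => pointwiseMultilinear (q n)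
  have hP : ∀ n, ‖P n‖ * ρ ^ n ≤ |C| := fun n =>
    (mul_le_mul_of_nonneg_right (norm_pointwiseMultilinear_le (q n)) (by positivity)).trans (hq n)
  refine ⟨P, ENNReal.ofReal ρ, ?_, by simpa using hρ, fun {w} hw => ?_⟩
  · exact P.le_radius_of_bound |C| fun n => by simpa [hρ.le] using hP n
  · have hw' : ‖w‖ < ρ := by
      rw [mem_eball_zero_iff, ← ofReal_norm, ENNReal.ofReal_lt_ofReal_iff hρ] at hw
      exact hw
    have hsum : Summable fun n => P n fun _ => w := by
      refine Summable.of_norm_bounded (g := fun n => |C| * (‖w‖ / ρ) ^ n)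
        ((summable_geometric_of_lt_one (by positivity) ((div_lt_one hρ).2 hw')).mul_left _)
        fun n => ?_
      refine ((P n).le_opNorm _).trans ?_
      rw [Finset.prod_const, Finset.card_univ, Fintype.card_fin, div_pow, mul_div_assoc',
        le_div_iff₀ (by positivity)]
      calc ‖P n‖ * ‖w‖ ^ n * ρ ^ n = ‖P n‖ * ρ ^ n * ‖w‖ ^ n := by ring
        _ ≤ |C| * ‖w‖ ^ n := by gcongr; exact hP n
    have heq : superposition f (u₀ + w) = ∑' n, P n fun _ => w := by
      ext k
      have hk : ∀ k, ‖w k‖ < ρ := fun k => (w.norm_coe_le_norm k).trans_lt hw'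
      have h1 := ((ContinuousMap.evalCLM ℝ k : C(K, W) →L[ℝ] W).hasSum hsum.hasSum)
      have h2 := (hC _ ⟨k, rfl⟩).2 (w k) ((hk k).trans_le (min_le_left _ _))
      rw [superposition_apply]
      · exact h2.unique h1
      · intro k
        refine AnalyticAt.continuousAt (𝕜 := ℝ) (hball ?_)
        refine Metric.mem_thickening_iff.2 ⟨u₀ k, ⟨k, rfl⟩, ?_⟩
        rw [dist_eq_norm, ContinuousMap.add_apply, add_sub_cancel_left]
        exact (hk k).trans_le (min_le_right _ _)
    rw [heq]
    exact hsum.hasSum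

end Superposition

/-! ### Primitives -/

section Primitive

open Set

variable {T : ℝ}

/-- The operator `u ↦ (t ↦ ∫₀ᵗ u)` on `C([0, T])`. -/
noncomputable def primitive (hT : 0 ≤ T) : C(Icc 0 T, ℝ) →L[ℝ] C(Icc 0 T, ℝ) :=
  LinearMap.mkContinuous
    { toFun := fun u => ⟨fun t => ∫ s in (0 : ℝ)..t, IccExtend hT u s,
        (intervalIntegral.continuous_primitive
          (fun a b => (u.continuous.Icc_extend' (h := hT)).intervalIntegrable a b) 0).comp
          continuous_subtype_val⟩
      map_add' := fun u v => by
        ext t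
        exact intervalIntegral.integral_add
          ((u.continuous.Icc_extend' (h := hT)).intervalIntegrable _ _)
          ((v.continuous.Icc_extend' (h := hT)).intervalIntegrable _ _)
      map_smul' := fun c u => by
        ext t
        exact intervalIntegral.integral_const_mul _ _ }
    T (fun u => by
      refine (ContinuousMap.norm_le _ (by positivity)).2 fun t => ?_
      refine (intervalIntegral.norm_integral_le_of_norm_le_const (C := ‖u‖)
        fun s _ => u.norm_coe_le_norm (projIcc 0 T hT s)).trans ?_
      rw [sub_zero, abs_of_nonneg t.2.1, mul_comm]
      exact mul_le_mul_of_nonneg_right t.2.2 (norm_nonneg _))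

theorem primitive_apply (hT : 0 ≤ T) (u : C(Icc 0 T, ℝ)) {f : ℝ → ℝ}
    (hf : ∀ t : Icc 0 T, u t = f t) (t : Icc 0 T) :
    primitive hT u t = ∫ s in (0 : ℝ)..t, f s := by
  change ∫ s in (0 : ℝ)..t, IccExtend hT u s = _
  refine intervalIntegral.integral_congr fun s hs => ?_
  rw [uIcc_of_le t.2.1] at hs
  have hs' : s ∈ Icc 0 T := ⟨hs.1, hs.2.trans t.2.2⟩
  rw [IccExtend_of_mem hT _ hs', hf]

end Primitive

/-! ### Division of analytic functions of two variables -/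

section TwoVariables

open scoped ContDiff

/-- Hadamard's lemma: the quotient of `h (b, e) - h (0, e)` by `b` is analytic, since it equals
`∫₀¹ ∂₁h (θ b, e) dθ`. -/
theorem AnalyticAt.exists_eq_add_fst_mul {h : ℝ × ℝ → ℝ} (hh : AnalyticAt ℝ h 0) :
    ∃ u : ℝ × ℝ → ℝ, AnalyticAt ℝ u 0 ∧ ∀ᶠ z in 𝓝 0, h z = h (0, z.2) + z.1 * u z := by
  let D : ℝ × ℝ → ℝ := fun z => fderiv ℝ h z (1, 0)
  have hD : ∀ {z}, AnalyticAt ℝ h z → AnalyticAt ℝ D z := fun hz =>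
    ((ContinuousLinearMap.apply ℝ ℝ ((1, 0) : ℝ × ℝ)).analyticAt _).comp hz.fderiv
  let c₁ : C(Set.Icc (0 : ℝ) 1, ℝ × ℝ) := ⟨fun θ => (θ, 0), by fun_prop⟩
  let c₂ : C(Set.Icc (0 : ℝ) 1, ℝ × ℝ) := ⟨fun _ => (0, 1), by fun_prop⟩
  let Λ : ℝ × ℝ → C(Set.Icc (0 : ℝ) 1, ℝ × ℝ) := fun z => z.1 • c₁ + z.2 • c₂
  have hΛ : AnalyticAt ℝ Λ 0 :=
    (analyticAt_fst.smul analyticAt_const).add (analyticAt_snd.smul analyticAt_const)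
  have hΛ0 : Λ 0 = 0 := by simp [Λ]
  have hΛz : ∀ z θ, Λ z θ = ((θ : ℝ) * z.1, z.2) := fun z θ => by
    simp [Λ, c₁, c₂, mul_comm]
  let I : C(Set.Icc (0 : ℝ) 1, ℝ) →L[ℝ] ℝ :=
    (ContinuousMap.evalCLM ℝ (⟨1, by simp⟩ : Set.Icc (0 : ℝ) 1)) ∘L primitive zero_le_one
  refine ⟨fun z => I (superposition D (Λ z)), ?_, ?_⟩
  · refine (I.analyticAt _).comp ?_
    refine AnalyticAt.comp (g := superposition D) ?_ hΛ
    refine analyticAt_superposition fun θ => ?_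
    rw [hΛ0]
    exact hD hh
  · obtain ⟨δ, hδ, hball⟩ := Metric.eventually_nhds_iff_ball.1 hh.eventually_analyticAt
    filter_upwards [Metric.ball_mem_nhds 0 hδ] with z hz
    have hmem : ∀ θ ∈ Set.Icc (0 : ℝ) 1, AnalyticAt ℝ h (θ * z.1, z.2) := fun θ hθ => by
      refine hball _ ?_
      rw [mem_ball_zero_iff] at hz ⊢
      refine lt_of_le_of_lt ?_ hz
      rw [Prod.norm_def, Prod.norm_def]
      refine max_le_max ?_ le_rfl
      simp only [norm_mul, Real.norm_of_nonneg hθ.1]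
      exact mul_le_of_le_one_left (norm_nonneg _) hθ.2
    have hI : I (superposition D (Λ z)) = ∫ θ in (0 : ℝ)..1, D (θ * z.1, z.2) := by
      refine primitive_apply zero_le_one _ (f := fun θ => D (θ * z.1, z.2)) (fun θ => ?_) _
      rw [superposition_apply (fun θ => ?_), hΛz]
      rw [hΛz]
      exact (hD (hmem θ θ.2)).continuousAt
    have hder : ∀ θ ∈ Set.uIcc (0 : ℝ) 1,
        HasDerivAt (fun θ : ℝ => h (θ * z.1, z.2)) (z.1 * D (θ * z.1, z.2)) θ := fun θ hθ => by
      rw [Set.uIcc_of_le zero_le_one] at hθ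
      have h1 := (hmem θ hθ).differentiableAt.hasFDerivAt
      have h2 : HasDerivAt (fun θ : ℝ => (θ * z.1, z.2)) (z.1, 0) θ :=
        (by simpa using (hasDerivAt_id θ).mul_const z.1 : HasDerivAt (fun θ => θ * z.1) z.1 θ).prodMk
          (hasDerivAt_const _ _)
      have h3 := h1.comp_hasDerivAt θ h2
      have h4 : ((z.1, 0) : ℝ × ℝ) = z.1 • ((1, 0) : ℝ × ℝ) := by simp
      rw [h4, map_smul] at h3
      exact h3
    have hcont : ContinuousOn (fun θ : ℝ => z.1 * D (θ * z.1, z.2)) (Set.uIcc (0 : ℝ) 1) :=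
      fun θ hθ => by
        rw [Set.uIcc_of_le zero_le_one] at hθ
        refine ContinuousAt.continuousWithinAt (continuousAt_const.mul ?_)
        exact ContinuousAt.comp (g := D) (f := fun θ : ℝ => (θ * z.1, z.2))
          (hD (hmem θ hθ)).continuousAt (by fun_prop)
    have := intervalIntegral.integral_eq_sub_of_hasDerivAt hder hcont.intervalIntegrable
    rw [intervalIntegral.integral_const_mul] at this
    simp only [hI, this]
    simp

/-- If `h (·, 0)` has order `n` at `0`, then `h (b, e) = ∑_{j < n} aⱼ(e) bʲ + bⁿ u (b, e)` with
`aⱼ(0) = 0` and a unit `u`. -/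
theorem AnalyticAt.exists_eq_sum_add_pow_mul_unit {n : ℕ} {h : ℝ × ℝ → ℝ} (hh : AnalyticAt ℝ h 0)
    (hn : analyticOrderAt (fun b => h (b, 0)) 0 = n) :
    ∃ (a : ℕ → ℝ → ℝ) (u : ℝ × ℝ → ℝ), (∀ j, AnalyticAt ℝ (a j) 0) ∧ (∀ j < n, a j 0 = 0) ∧
      AnalyticAt ℝ u 0 ∧ u 0 ≠ 0 ∧
      ∀ᶠ z in 𝓝 0, h z = ∑ j ∈ Finset.range n, a j z.2 * z.1 ^ j + z.1 ^ n * u z := by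
  induction n generalizing h with
  | zero =>
    refine ⟨fun _ _ => 0, h, fun _ => analyticAt_const, by simp, hh, ?_, by simp⟩
    have h1 : AnalyticAt ℝ (fun b : ℝ => h (b, 0)) 0 :=
      AnalyticAt.comp (g := h) (f := fun b : ℝ => (b, (0 : ℝ))) hh (by fun_prop)
    rw [Nat.cast_zero, h1.analyticOrderAt_eq_zero] at hn
    exact hn
  | succ n ih =>
    obtain ⟨v, hv, hhv⟩ := hh.exists_eq_add_fst_mul
    have hrow : AnalyticAt ℝ (fun b : ℝ => h (b, 0)) 0 :=
      AnalyticAt.comp (g := h) (f := fun b : ℝ => (b, (0 : ℝ))) hh (by fun_prop)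
    have hvrow : AnalyticAt ℝ (fun b : ℝ => v (b, 0)) 0 :=
      AnalyticAt.comp (g := v) (f := fun b : ℝ => (b, (0 : ℝ))) hv (by fun_prop)
    have h00 : h (0, 0) = 0 := by
      have : analyticOrderAt (fun b => h (b, 0)) 0 ≠ 0 := by
        rw [hn]; simp
      exact (analyticOrderAt_ne_zero.1 this).2
    have hc : Tendsto (fun b : ℝ => (b, (0 : ℝ))) (𝓝 0) (𝓝 0) :=
      ContinuousAt.tendsto (f := fun b : ℝ => (b, (0 : ℝ))) (x := 0) (by fun_prop)
    have hvn : analyticOrderAt (fun b => v (b, 0)) 0 = n := by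
      have h1 : (fun b => h (b, 0)) =ᶠ[𝓝 0] (id * fun b => v (b, 0)) := by
        filter_upwards [hc.eventually hhv] with b hb
        simpa [h00] using hb
      rw [analyticOrderAt_congr h1, analyticOrderAt_mul analyticAt_id hvrow,
        analyticOrderAt_id] at hn
      push_cast at hn
      rw [add_comm] at hn
      generalize analyticOrderAt (fun b => v (b, 0)) 0 = x at hn ⊢
      induction x using ENat.recTopCoe with
      | top => exact absurd hn (by exact_mod_cast ENat.top_ne_natCast (n + 1))
      | coe x =>
        have : x + 1 = n + 1 := by exact_mod_cast hn
        exact congrArg _ (Nat.succ_injective this)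
    obtain ⟨a, u, ha, ha0, hu, hu0, hev⟩ := ih hv hvn
    refine ⟨fun j => Nat.casesOn j (fun e => h (0, e)) a, u, ?_, ?_, hu, hu0, ?_⟩
    · rintro (_ | j)
      · exact AnalyticAt.comp (g := h) (f := fun e : ℝ => ((0 : ℝ), e)) hh (by fun_prop)
      · exact ha j
    · rintro (_ | j) hj
      · exact h00
      · exact ha0 j (by omega)
    · filter_upwards [hhv, hev] with z h1 h2
      rw [Finset.sum_range_succ']
      change h z = ∑ j ∈ Finset.range n, a j z.2 * z.1 ^ (j + 1) + h (0, z.2) * z.1 ^ 0 +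
        z.1 ^ (n + 1) * u z
      rw [h1, h2, mul_add, Finset.mul_sum, Finset.sum_congr rfl fun j _ => (by ring :
        a j z.2 * z.1 ^ (j + 1) = z.1 * (a j z.2 * z.1 ^ j))]
      ring

/-- The analytic implicit function theorem for a scalar equation `g (b, e) = 0`. -/
theorem AnalyticAt.exists_implicit {g : ℝ × ℝ → ℝ} (hg : AnalyticAt ℝ g 0) (hg0 : g 0 = 0)
    (hg' : deriv (fun b => g (b, 0)) 0 ≠ 0) :
    ∃ φ : ℝ → ℝ, AnalyticAt ℝ φ 0 ∧ φ 0 = 0 ∧ ∀ᶠ e in 𝓝 0, g (φ e, e) = 0 := by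
  let f : ℝ × ℝ → ℝ := fun z => g (z.2, z.1)
  have hf : AnalyticAt ℝ f 0 :=
    AnalyticAt.comp (g := g) (f := fun z : ℝ × ℝ => (z.2, z.1)) hg (analyticAt_snd.prod analyticAt_fst)
  have hfc : ContDiffAt ℝ ω f 0 := hf.contDiffAt
  have hder : (fderiv ℝ f 0 ∘L .inr ℝ ℝ ℝ) 1 = deriv (fun b => g (b, 0)) 0 := by
    have h1 : HasDerivAt (fun b : ℝ => ((0 : ℝ), b)) (0, 1) 0 :=
      (hasDerivAt_const _ _).prodMk (hasDerivAt_id _)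
    have h2 := (hf.differentiableAt.hasFDerivAt).comp_hasDerivAt (x := (0 : ℝ))
      (f := fun b : ℝ => ((0 : ℝ), b)) h1
    exact h2.deriv.symm
  have hinv : (fderiv ℝ f 0 ∘L .inr ℝ ℝ ℝ).IsInvertible := by
    refine ⟨ContinuousLinearEquiv.unitsEquivAut ℝ (Units.mk0 _ hg'), ?_⟩
    ext
    rw [hder]
    simp
  refine ⟨hfc.implicitFunction (by simp) hinv, ?_, ?_, ?_⟩
  · exact (hfc.contDiffAt_implicitFunction (by simp) hinv).analyticAt
  · exact hfc.implicitFunction_apply_self (by simp) hinv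
  · filter_upwards [hfc.eventually_apply_implicitFunction (by simp) hinv] with e he
    have : f 0 = 0 := hg0
    rw [this] at he
    exact he

/-- The partial derivative of a function of two variables with respect to the first one. -/
noncomputable def partialFst (h : ℝ × ℝ → ℝ) (z : ℝ × ℝ) : ℝ := fderiv ℝ h z (1, 0)

theorem AnalyticAt.partialFst_iterate {h : ℝ × ℝ → ℝ} {z : ℝ × ℝ} (hz : AnalyticAt ℝ h z) (k : ℕ) :
    AnalyticAt ℝ (partialFst^[k] h) z := by
  induction k with
  | zero => exact hz
  | succ k ih =>
    rw [Function.iterate_succ_apply']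
    exact ((ContinuousLinearMap.apply ℝ ℝ ((1, 0) : ℝ × ℝ)).analyticAt _).comp ih.fderiv

theorem AnalyticAt.iteratedDeriv_fst {h : ℝ × ℝ → ℝ} {b e : ℝ} (hz : AnalyticAt ℝ h (b, e))
    (k : ℕ) : iteratedDeriv k (fun b => h (b, e)) b = partialFst^[k] h (b, e) := by
  induction k generalizing b with
  | zero => simp
  | succ k ih =>
    rw [iteratedDeriv_succ, Function.iterate_succ_apply']
    have hc : Tendsto (fun b : ℝ => (b, e)) (𝓝 b) (𝓝 (b, e)) :=
      ContinuousAt.tendsto (f := fun b : ℝ => (b, e)) (by fun_prop)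
    have h1 : iteratedDeriv k (fun b => h (b, e)) =ᶠ[𝓝 b] fun b => partialFst^[k] h (b, e) := by
      filter_upwards [hc.eventually hz.eventually_analyticAt] with b' hb'
      exact ih hb'
    rw [h1.deriv_eq]
    exact (((hz.partialFst_iterate k).differentiableAt.hasFDerivAt).comp_hasDerivAt (x := b)
      (f := fun b : ℝ => (b, e)) ((hasDerivAt_id _).prodMk (hasDerivAt_const _ _))).deriv

/-- Tschirnhaus transformation: if `h (·, 0)` has order `n + 1` at `0`, an analytic translation of
the first variable removes the coefficient of degree `n`. -/
theorem AnalyticAt.exists_tschirnhaus {n : ℕ} {h : ℝ × ℝ → ℝ} (hh : AnalyticAt ℝ h 0)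
    (hn : analyticOrderAt (fun b => h (b, 0)) 0 = (n + 1 : ℕ)) :
    ∃ φ : ℝ → ℝ, AnalyticAt ℝ φ 0 ∧ φ 0 = 0 ∧
      ∀ᶠ e in 𝓝 0, iteratedDeriv n (fun b => h (φ e + b, e)) 0 = 0 := by
  have hrow : AnalyticAt ℝ (fun b : ℝ => h (b, 0)) 0 :=
    AnalyticAt.comp (g := h) (f := fun b : ℝ => (b, (0 : ℝ))) hh (by fun_prop)
  rw [analyticOrderAt_eq_nat_iff_iteratedDeriv_eq_zero hrow] at hn
  have hh' : AnalyticAt ℝ h (0, 0) := hh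
  obtain ⟨φ, hφ, hφ0, hev⟩ := (hh.partialFst_iterate n).exists_implicit
    (by rw [← hn.1 n (Nat.lt_succ_self n), hh'.iteratedDeriv_fst]; rfl) (by
      have h1 := hn.2
      rw [hh'.iteratedDeriv_fst, Function.iterate_succ_apply'] at h1
      have h2 := (((hh'.partialFst_iterate n).differentiableAt.hasFDerivAt).comp_hasDerivAt (x := 0)
        (f := fun b : ℝ => (b, (0 : ℝ))) ((hasDerivAt_id _).prodMk (hasDerivAt_const _ _))).deriv
      exact fun h3 => h1 (h2.symm.trans h3))
  refine ⟨φ, hφ, hφ0, ?_⟩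
  have hc : Tendsto (fun e : ℝ => (φ e, e)) (𝓝 0) (𝓝 (0, 0)) := by
    have : ContinuousAt (fun e : ℝ => (φ e, e)) 0 := hφ.continuousAt.prodMk continuousAt_id
    simpa [ContinuousAt, hφ0] using this
  filter_upwards [hev, hc.eventually hh'.eventually_analyticAt] with e he hae
  have := iteratedDeriv_comp_const_add n (fun b => h (b, e)) (φ e)
  rw [this]
  simp only [add_zero]
  rw [hae.iteratedDeriv_fst, he]

end TwoVariables

/-! ### Real roots of odd multiplicity of sparse polynomials -/

section Polynomials

open Polynomial

theorem Polynomial.exists_isRoot_real_of_odd_natDegree {P : ℝ[X]} (hP : Odd P.natDegree) :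
    ∃ x, P.IsRoot x := by
  wlog hlc : 0 ≤ P.leadingCoeff generalizing P
  · obtain ⟨x, hx⟩ := this (P := -P) (by simpa) (by
      rw [leadingCoeff_neg]; linarith)
    exact ⟨x, by simpa using hx⟩
  have hdeg : 0 < P.degree := natDegree_pos_iff_degree_pos.1 hP.pos
  have h1 := P.tendsto_atTop_of_leadingCoeff_nonneg hdeg hlc
  have hX : (-X : ℝ[X]).natDegree ≠ 0 := by simp
  have h2 := (P.comp (-X)).tendsto_atBot_of_leadingCoeff_nonpos
    (natDegree_pos_iff_degree_pos.1 (by rw [natDegree_comp]; simpa using hP.pos)) (by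
      rw [leadingCoeff_comp hX, leadingCoeff_neg, leadingCoeff_X, hP.neg_one_pow]
      linarith)
  obtain ⟨a, ha⟩ := (h2.eventually_le_atBot 0).exists
  obtain ⟨b, hb⟩ := (h1.eventually_ge_atTop 0).exists
  rw [eval_comp] at ha
  exact mem_range_of_exists_le_of_exists_ge P.continuous ⟨_, ha⟩ ⟨b, hb⟩

/-- After dividing out all real roots there remains a polynomial without real roots, hence of even
degree. -/
theorem Polynomial.exists_odd_rootMultiplicity {P : ℝ[X]} (hP : Odd P.natDegree) :
    ∃ z, Odd (P.rootMultiplicity z) := by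
  by_contra! hcon
  obtain ⟨R, hR, hcard, hroots⟩ := P.exists_prod_multiset_X_sub_C_mul
  have hR0 : R ≠ 0 := by
    rintro rfl
    rw [mul_zero] at hR
    rw [← hR] at hP
    simp at hP
  have hReven : Even R.natDegree := by
    by_contra hodd
    obtain ⟨x, hx⟩ := exists_isRoot_real_of_odd_natDegree (Nat.not_even_iff_odd.1 hodd)
    have := (mem_roots hR0).2 hx
    simp [hroots] at this
  have hc : Even P.roots.card := by
    rw [← Multiset.toFinset_sum_count_eq]
    refine Finset.even_sum _ fun z _ => ?_
    rw [count_roots]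
    exact Nat.not_odd_iff_even.1 (hcon z)
  rw [← hcard] at hP
  exact Nat.not_even_iff_odd.2 hP (hc.add hReven)

theorem Nat.mul_factorial_dvd_factorial {m k n : ℕ} (hm : 0 < m) (h : m + k ≤ n) :
    m * k.factorial ∣ n.factorial :=
  (Nat.mul_dvd_mul (Nat.dvd_factorial hm le_rfl) dvd_rfl).trans
    ((Nat.factorial_mul_factorial_dvd_factorial_add m k).trans (Nat.factorial_dvd_factorial h))

theorem Polynomial.analyticOrderAt_eval {Q : ℝ[X]} {c : ℝ} {k : ℕ} {g : ℝ → ℝ}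
    (hg : AnalyticAt ℝ g c) (hgc : g c ≠ 0) (h : ∀ x, Q.eval x = (x - c) ^ k * g x) :
    analyticOrderAt (fun x => Q.eval x) c = k := by
  have hQ : AnalyticAt ℝ (fun x => Q.eval x) c := by
    simp only [h]
    fun_prop
  rw [hQ.analyticOrderAt_eq_natCast]
  exact ⟨g, hg, hgc, Eventually.of_forall fun x => by simp [h]⟩

/-- An edge polynomial of odd degree `n` of a Newton polygon, whose exponents are congruent to `n`
modulo the denominator `m` of the slope, has a real root of odd order `k < n` for which the
denominators still available satisfy `m * k! ∣ n!`. It is `c ^ r * P (c ^ m)` with `P (0) ≠ 0`: if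
`r` is odd the root `0` will do, and otherwise `m` and `deg P` are odd, so that the `m`-th root of a
root of odd multiplicity of `P` will do. -/
theorem Polynomial.exists_odd_order_root {Q : ℝ[X]} {m : ℕ} (hm : 0 < m) (hodd : Odd Q.natDegree)
    (hdvd : ∀ j < Q.natDegree, Q.coeff j ≠ 0 → m ∣ Q.natDegree - j)
    (hsub : Q.coeff (Q.natDegree - 1) = 0) (hne : ∃ j < Q.natDegree, Q.coeff j ≠ 0) :
    ∃ (c : ℝ) (k : ℕ), Odd k ∧ k < Q.natDegree ∧ m * k.factorial ∣ Q.natDegree.factorial ∧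
      analyticOrderAt (fun x => Q.eval x) c = k := by
  set n := Q.natDegree with hn
  have hQ0 : Q ≠ 0 := by
    rintro rfl
    simp [hn] at hodd
  obtain ⟨Q₁, hQ₁, hQ₁0⟩ := Q.exists_eq_pow_rootMultiplicity_mul_and_not_dvd hQ0 0
  set r := Q.rootMultiplicity 0
  rw [C_0, sub_zero] at hQ₁ hQ₁0
  rw [X_dvd_iff] at hQ₁0
  have hcoeff : ∀ i, Q.coeff (i + r) = Q₁.coeff i := fun i => by rw [hQ₁, coeff_X_pow_mul]
  have hQ₁ne : Q₁ ≠ 0 := by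
    rintro rfl
    simp at hQ₁0
  have hdeg : n = r + Q₁.natDegree := by
    rw [hn, hQ₁, natDegree_X_pow_mul _ hQ₁ne, add_comm]
  obtain ⟨j, hjn, hj⟩ := hne
  have hrj : r ≤ j := by
    by_contra! h
    rw [hQ₁, coeff_X_pow_mul', if_neg (by omega)] at hj
    exact hj rfl
  have hrn : r < n := by omega
  have hmr : m ∣ n - r := hdvd r hrn (by rwa [← zero_add r, hcoeff])
  have hexp : Q₁ = expand ℝ m (contract m Q₁) := by
    ext i
    rw [coeff_expand hm, coeff_contract hm.ne']
    split_ifs with hi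
    · rw [Nat.div_mul_cancel hi]
    · by_contra hi0
      have hile : i ≤ Q₁.natDegree := le_natDegree_of_ne_zero hi0
      rcases (show i + r ≤ n by omega).lt_or_eq with h | h
      · have h1 := hdvd (i + r) h (by rwa [hcoeff])
        have h2 := Nat.dvd_sub hmr h1
        rw [show n - r - (n - (i + r)) = i by omega] at h2
        exact hi h2
      · rw [show n - r = i by omega] at hmr
        exact hi hmr
  set P := contract m Q₁
  set d := P.natDegree
  have hd : Q₁.natDegree = d * m := by
    rw [hexp, natDegree_expand]
  have hd1 : 0 < d := by
    rcases Nat.eq_zero_or_pos d with h | h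
    · rw [h, zero_mul] at hd; omega
    · exact h
  have heval : ∀ x, Q.eval x = x ^ r * P.eval (x ^ m) := fun x => by
    rw [hQ₁, eval_mul, hexp, expand_eval]; simp
  have hP0 : P.eval 0 ≠ 0 := by
    rw [← coeff_zero_eq_eval_zero, coeff_contract hm.ne', zero_mul]
    exact hQ₁0
  rcases Nat.even_or_odd r with hr | hr
  · have hmd : Odd (d * m) := by
      rw [← hd]
      rw [hdeg] at hodd
      exact (Nat.odd_add'.1 hodd).2 hr
    obtain ⟨hdodd, hmodd⟩ := Nat.odd_mul.1 hmd
    obtain ⟨z, hz⟩ := exists_odd_rootMultiplicity hdodd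
    have hPne : P ≠ 0 := by
      rintro h
      simp [h] at hP0
    obtain ⟨R, hR, hRz⟩ := P.exists_eq_pow_rootMultiplicity_mul_and_not_dvd hPne z
    set k := P.rootMultiplicity z
    rw [dvd_iff_isRoot, IsRoot.def] at hRz
    have hPz : P.IsRoot z := (rootMultiplicity_pos hPne).1 hz.pos
    have hz0 : z ≠ 0 := by
      rintro rfl
      exact hP0 hPz
    obtain ⟨c, hc⟩ : ∃ c : ℝ, c ^ m = z := by
      obtain ⟨c, hc⟩ := exists_isRoot_real_of_odd_natDegree (P := X ^ m - C z)
        (by rwa [natDegree_X_pow_sub_C])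
      exact ⟨c, by simpa [sub_eq_zero] using hc⟩
    have hc0 : c ≠ 0 := by
      rintro rfl
      rw [zero_pow hm.ne'] at hc
      exact hz0 hc.symm
    have hkd : k ≤ d := by
      have := natDegree_le_of_dvd (P.pow_rootMultiplicity_dvd z) hPne
      simpa using this
    have hmk : m * k ≤ n := by
      rw [hdeg, hd, mul_comm]
      exact (Nat.mul_le_mul_right m hkd).trans (Nat.le_add_left _ _)
    have hkn : k < n := by
      have hkn' : k ≤ n := (Nat.le_mul_of_pos_left k hm).trans hmk
      refine hkn'.lt_of_ne fun hkeq => ?_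
      -- the only possibility left is `Q = a (c - z)ⁿ`, excluded by the vanishing coefficient
      have hdm : d ≤ d * m := Nat.le_mul_of_pos_right d hm
      have hr0 : r = 0 := by omega
      have hm1 : m = 1 := by
        have : m * k = k := le_antisymm (by omega) (Nat.le_mul_of_pos_left k hm)
        exact Nat.eq_of_mul_eq_mul_right hz.pos (by omega)
      have hQP : Q = P := by
        refine funext fun x => ?_
        rw [heval, hr0, hm1]; simp
      have hRdeg : R.natDegree = 0 := by
        have h1 : P.natDegree = k + R.natDegree := by
          have hR' : R ≠ 0 := by
            rintro rfl
            simp at hRz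
          conv_lhs => rw [hR]
          rw [natDegree_mul (pow_ne_zero _ (X_sub_C_ne_zero z)) hR', natDegree_pow,
            natDegree_X_sub_C, mul_one]
        omega
      obtain ⟨a, ha⟩ := natDegree_eq_zero.1 hRdeg
      rw [hQP, hR, ← ha, coeff_mul_C, sub_eq_add_neg, ← C_neg, coeff_X_add_C_pow, hkeq,
        Nat.choose_symm (by omega : 1 ≤ n),
        show n - (n - 1) = 1 by omega, pow_one, Nat.choose_one_right] at hsub
      have ha0 : a ≠ 0 := by
        rintro rfl
        simp [← ha] at hRz
      have hn0 : (n : ℝ) ≠ 0 := by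
        have : n ≠ 0 := by omega
        exact_mod_cast this
      exact mul_ne_zero (mul_ne_zero (neg_ne_zero.2 hz0) hn0) ha0 hsub
    refine ⟨c, k, hz, hkn, ?_, ?_⟩
    · rcases eq_or_ne k 1 with hk1 | hk1
      · rw [hk1, Nat.factorial_one, mul_one]
        exact Nat.dvd_factorial hm (by nlinarith [hz.pos])
      · have hk3 : 2 ≤ k := by have := hz.pos; omega
        refine Nat.mul_factorial_dvd_factorial hm ?_
        rcases eq_or_ne m 1 with hm1 | hm1
        · omega
        · have hm2 : 2 ≤ m := by omega
          nlinarith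
    · refine analyticOrderAt_eval
        (g := fun x => x ^ r * ((∑ i ∈ Finset.range m, x ^ i * c ^ (m - 1 - i)) ^ k *
          R.eval (x ^ m))) ?_ ?_ ?_
      · have h1 : AnalyticAt ℝ (fun x => R.eval (x ^ m)) c :=
          (AnalyticOnNhd.eval_polynomial R (c ^ m) trivial).comp
            (f := fun x : ℝ => x ^ m) (by fun_prop)
        have h2 : AnalyticAt ℝ (fun x => ∑ i ∈ Finset.range m, x ^ i * c ^ (m - 1 - i)) c :=
          Finset.analyticAt_fun_sum _ fun i _ => by fun_prop
        exact (analyticAt_id.pow r).mul ((h2.pow k).mul h1)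
      · rw [geom_sum₂_self, hc]
        have : (m : ℝ) ≠ 0 := by exact_mod_cast hm.ne'
        exact mul_ne_zero (pow_ne_zero _ hc0) (mul_ne_zero
          (pow_ne_zero _ (mul_ne_zero this (pow_ne_zero _ hc0))) hRz)
      · intro x
        have h1 : P.eval (x ^ m) = (x ^ m - z) ^ k * R.eval (x ^ m) := by
          conv_lhs => rw [hR]
          simp
        rw [heval, h1, ← hc, ← (Commute.all x c).geom_sum₂_mul, mul_pow]
        ring
  · refine ⟨0, r, hr, hrn, Nat.mul_factorial_dvd_factorial hm ?_, ?_⟩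
    · have := Nat.le_of_dvd (by omega) hmr
      omega
    · refine analyticOrderAt_eval (g := fun x => P.eval (x ^ m)) ?_ ?_ fun x => ?_
      · exact (AnalyticOnNhd.eval_polynomial P ((0 : ℝ) ^ m) trivial).comp
            (f := fun x : ℝ => x ^ m) (by fun_prop)
      · rwa [zero_pow hm.ne']
      · rw [heval, sub_zero]

end Polynomials

/-! ### Real Puiseux branches -/

section Puiseux

/-- The first side of the Newton polygon of `∑_{j < n} aⱼ(e) bʲ + bⁿ`, of slope `k / m` in lowest
terms: substituting `e = s ^ m` makes `aⱼ` divisible by `s ^ (k (n - j))`, and the quotients `wⱼ` do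
not all vanish at `0`. -/
theorem exists_newton_slope {n : ℕ} {a : ℕ → ℝ → ℝ} (ha : ∀ j, AnalyticAt ℝ (a j) 0)
    (ha0 : ∀ j < n, a j 0 = 0) (hne : ∃ j < n, ¬ ∀ᶠ s in 𝓝 0, a j s = 0) :
    ∃ k m : ℕ, 0 < k ∧ 0 < m ∧ ∃ w : ℕ → ℝ → ℝ, (∀ j, AnalyticAt ℝ (w j) 0) ∧
      (∀ j < n, ∀ᶠ s in 𝓝 0, a j (s ^ m) = s ^ (k * (n - j)) * w j s) ∧
      (∀ j < n, w j 0 ≠ 0 → m ∣ n - j) ∧ (∃ j < n, w j 0 ≠ 0) ∧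
      (∀ j < n, (∀ᶠ s in 𝓝 0, a j s = 0) → w j 0 = 0) := by
  classical
  have hfac : ∀ j, ∃ (v : ℕ) (c : ℝ → ℝ), AnalyticAt ℝ c 0 ∧
      ((¬ ∀ᶠ s in 𝓝 0, a j s = 0) → c 0 ≠ 0 ∧ ∀ᶠ s in 𝓝 0, a j s = s ^ v * c s) := fun j => by
    by_cases h : ∀ᶠ s in 𝓝 0, a j s = 0
    · exact ⟨0, 0, analyticAt_const, fun h' => absurd h h'⟩
    · obtain ⟨v, c, hc, hc0, hev⟩ := (ha j).exists_eventuallyEq_pow_smul_nonzero_iff.2 h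
      exact ⟨v, c, hc, fun _ => ⟨hc0, by simpa using hev⟩⟩
  choose v c hc hvc using hfac
  let S : Finset ℕ := (Finset.range n).filter fun j => ¬ ∀ᶠ s in 𝓝 0, a j s = 0
  have hS : ∀ {j}, j ∈ S ↔ j < n ∧ ¬ ∀ᶠ s in 𝓝 0, a j s = 0 := by simp [S]
  have hv : ∀ j ∈ S, 0 < v j := fun j hj => by
    obtain ⟨hjn, hj⟩ := hS.1 hj
    refine Nat.pos_of_ne_zero fun h => (hvc j hj).1 ?_
    have := (hvc j hj).2.self_of_nhds
    rw [ha0 j hjn, h] at this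
    simpa using this.symm
  -- `v j` is the order of `aⱼ`, and `k / m` the smallest of the slopes `v j / (n - j)`
  obtain ⟨i, hi, hmin⟩ := S.exists_min_image (fun j => (v j : ℚ) / ((n - j : ℕ) : ℚ))
    (let ⟨j, hj⟩ := hne; ⟨j, hS.2 hj⟩)
  have hin : 0 < n - i := Nat.sub_pos_of_lt (hS.1 hi).1
  have hcross : ∀ j ∈ S, v i * (n - j) ≤ v j * (n - i) := fun j hj => by
    have h1 := hmin j hj
    have hjn : 0 < n - j := Nat.sub_pos_of_lt (hS.1 hj).1
    rw [div_le_div_iff₀ (by exact_mod_cast hin) (by exact_mod_cast hjn)] at h1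
    exact_mod_cast h1
  obtain ⟨g, k, m, hg, hkm, hk, hm⟩ : ∃ g k m : ℕ, 0 < g ∧ k.Coprime m ∧ v i = k * g ∧
      n - i = m * g := Nat.exists_coprime' (Nat.gcd_pos_of_pos_left _ (hv i hi))
  have hk0 : 0 < k := Nat.pos_of_ne_zero fun h => by
    have := hv i hi
    rw [hk, h, zero_mul] at this
    exact this.false
  have hm0 : 0 < m := Nat.pos_of_ne_zero fun h => by
    rw [hm, h, zero_mul] at hin
    exact hin.false
  have hle : ∀ j ∈ S, k * (n - j) ≤ m * v j := fun j hj => by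
    have h1 := hcross j hj
    rw [hk, hm] at h1
    refine Nat.le_of_mul_le_mul_right ?_ hg
    calc k * (n - j) * g = k * g * (n - j) := by ring
      _ ≤ _ := h1
      _ = _ := by ring
  have hpow : Tendsto (fun s : ℝ => s ^ m) (𝓝 0) (𝓝 0) := by
    have : ContinuousAt (fun s : ℝ => s ^ m) 0 := by fun_prop
    simpa [ContinuousAt, zero_pow hm0.ne'] using this
  refine ⟨k, m, hk0, hm0,
    fun j s => if j ∈ S then s ^ (m * v j - k * (n - j)) * c j (s ^ m) else 0, ?_, ?_, ?_, ?_, ?_⟩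
  · intro j
    by_cases hj : j ∈ S
    · simp only [hj, if_true]
      have h1 : AnalyticAt ℝ (c j) ((fun s : ℝ => s ^ m) 0) := by
        simpa [zero_pow hm0.ne'] using hc j
      exact (analyticAt_id.pow _).mul (h1.comp (f := fun s : ℝ => s ^ m) (by fun_prop))
    · simp only [hj, if_false]
      exact analyticAt_const
  · intro j hjn
    by_cases hj : j ∈ S
    · simp only [hj, if_true]
      filter_upwards [hpow.eventually (hvc j (hS.1 hj).2).2] with s hs
      rw [hs, ← mul_assoc, ← pow_add, Nat.add_sub_cancel' (hle j hj), pow_mul]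
    · have h0 : ∀ᶠ s in 𝓝 0, a j s = 0 := by
        by_contra h
        exact hj (hS.2 ⟨hjn, h⟩)
      simp only [hj, if_false, mul_zero]
      exact hpow.eventually h0
  · intro j hjn hwj
    by_cases hj : j ∈ S
    · simp only [hj, if_true] at hwj
      have h1 : m * v j - k * (n - j) = 0 := by
        by_contra h
        rw [zero_pow h, zero_mul] at hwj
        exact hwj rfl
      have h2 : m * v j = k * (n - j) := le_antisymm (Nat.sub_eq_zero_iff_le.1 h1) (hle j hj)
      exact hkm.symm.dvd_of_dvd_mul_left ⟨v j, h2.symm⟩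
    · simp [hj] at hwj
  · refine ⟨i, (hS.1 hi).1, ?_⟩
    have h1 : m * v i - k * (n - i) = 0 := by
      rw [hk, hm]
      exact Nat.sub_eq_zero_of_le (le_of_eq (by ring))
    simp only [hi, if_true, h1, pow_zero, one_mul, zero_pow hm0.ne']
    exact (hvc i (hS.1 hi).2).1
  · intro j _ h0
    have hj : j ∉ S := fun hj => (hS.1 hj).2 h0
    simp [hj]

/-- In an expansion `f (b) = ∑_{j ≤ n} aⱼ bʲ + b ^ (n + 1) u (b)` the coefficient `aₙ` is
`f⁽ⁿ⁾(0) / n!`, so it vanishes with `f⁽ⁿ⁾(0)`. -/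
theorem coeff_eq_zero_of_iteratedDeriv_eq_zero {n : ℕ} {f u : ℝ → ℝ} {a : ℕ → ℝ}
    (hu : AnalyticAt ℝ u 0) (hf : iteratedDeriv n f 0 = 0)
    (h : ∀ᶠ b in 𝓝 0, f b = ∑ j ∈ Finset.range (n + 1), a j * b ^ j + b ^ (n + 1) * u b) :
    a n = 0 := by
  rw [EventuallyEq.iteratedDeriv_eq n h] at hf
  have hr : AnalyticAt ℝ (fun b : ℝ => b ^ (n + 1) * u b) 0 := by fun_prop
  have h1 : iteratedDeriv n (fun b : ℝ => b ^ (n + 1) * u b) 0 = 0 := by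
    refine (natCast_le_analyticOrderAt_iff_iteratedDeriv_eq_zero (n := n + 1) hr).1 ?_ n
      (Nat.lt_succ_self n)
    rw [natCast_le_analyticOrderAt hr]
    exact ⟨u, hu, by simp⟩
  rw [iteratedDeriv_fun_add (ContDiffAt.sum fun j _ => by fun_prop) hr.contDiffAt, h1, add_zero,
    iteratedDeriv_fun_sum (fun j _ => by fun_prop), Finset.sum_range_succ,
    Finset.sum_eq_zero] at hf
  · rw [iteratedDeriv_const_mul_field, iteratedDeriv_fun_pow_zero] at hf
    simpa [Nat.factorial_ne_zero] using hf
  · intro j hj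
    rw [iteratedDeriv_const_mul_field, iteratedDeriv_fun_pow_zero]
    simp [(Finset.mem_range.1 hj).ne']

/-- Puiseux's theorem for odd multiplicity: if `h (·, 0)` has a zero of odd order `n` at `0`, the
equation `h (b, e) = 0` has a real branch which is an analytic function of `e ^ (1 / n!)`. The proof
is by induction on `n`: after a Tschirnhaus transformation, the blow-up along the first side of the
Newton polygon leads to a zero of smaller odd order. -/
theorem exists_puiseux_branch {n : ℕ} (hodd : Odd n) {h : ℝ × ℝ → ℝ} (hh : AnalyticAt ℝ h 0)
    (hn : analyticOrderAt (fun b => h (b, 0)) 0 = n) :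
    ∃ b : ℝ → ℝ, AnalyticAt ℝ b 0 ∧ b 0 = 0 ∧ ∀ᶠ s in 𝓝 0, h (b s, s ^ n.factorial) = 0 := by
  induction n using Nat.strong_induction_on generalizing h with
  | h n ih =>
  obtain ⟨n', rfl⟩ : ∃ n', n = n' + 1 := ⟨n - 1, by have := hodd.pos; omega⟩
  obtain ⟨φ, hφ, hφ0, hφev⟩ := hh.exists_tschirnhaus hn
  let h₁ : ℝ × ℝ → ℝ := fun z => h (φ z.2 + z.1, z.2)
  have hh₁ : AnalyticAt ℝ h₁ 0 := by
    have h1 : AnalyticAt ℝ (fun z : ℝ × ℝ => φ z.2) 0 :=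
      AnalyticAt.comp (g := φ) (f := fun z : ℝ × ℝ => z.2) hφ analyticAt_snd
    have h2 : AnalyticAt ℝ (fun z : ℝ × ℝ => (φ z.2 + z.1, z.2)) 0 :=
      (h1.add analyticAt_fst).prod analyticAt_snd
    refine AnalyticAt.comp (g := h) (f := fun z : ℝ × ℝ => (φ z.2 + z.1, z.2)) ?_ h2
    change AnalyticAt ℝ h (φ 0 + 0, 0)
    rw [hφ0, add_zero]
    exact hh
  obtain ⟨a, u, ha, ha0, hu, hu0, hdec⟩ := hh₁.exists_eq_sum_add_pow_mul_unit (n := n' + 1)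
    (by simpa [h₁, hφ0] using hn)
  have hswap : Tendsto (fun z : ℝ × ℝ => (z.2, z.1)) (𝓝 (0, 0)) (𝓝 0) :=
    ContinuousAt.tendsto (f := fun z : ℝ × ℝ => (z.2, z.1)) (x := (0, 0)) (by fun_prop)
  have hrow : Tendsto (fun e : ℝ => ((0 : ℝ), e)) (𝓝 0) (𝓝 0) :=
    ContinuousAt.tendsto (f := fun e : ℝ => ((0 : ℝ), e)) (x := 0) (by fun_prop)
  have hsub : ∀ᶠ e in 𝓝 0, a n' e = 0 := by
    filter_upwards [hφev, (hswap.eventually hdec).curry_nhds,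
      hrow.eventually hu.eventually_analyticAt] with e he1 he2 he3
    refine coeff_eq_zero_of_iteratedDeriv_eq_zero (f := fun b => h₁ (b, e))
      (u := fun b => u (b, e)) (a := fun j => a j e) ?_ he1 he2
    exact AnalyticAt.comp (g := u) (f := fun b : ℝ => (b, e)) he3 (by fun_prop)
  by_cases hne : ∃ j < n' + 1, ¬ ∀ᶠ s in 𝓝 0, a j s = 0
  swap
  · -- all the coefficients vanish, and the translation itself is a branch
    push Not at hne
    have hpow : Tendsto (fun s : ℝ => s ^ (n' + 1).factorial) (𝓝 0) (𝓝 0) := by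
      have : ContinuousAt (fun s : ℝ => s ^ (n' + 1).factorial) 0 := by fun_prop
      simpa [ContinuousAt, Nat.factorial_ne_zero] using this
    refine ⟨fun s => φ (s ^ (n' + 1).factorial), ?_, by simp [Nat.factorial_ne_zero, hφ0], ?_⟩
    · refine AnalyticAt.comp (g := φ) (f := fun s : ℝ => s ^ (n' + 1).factorial) ?_ (by fun_prop)
      simpa [Nat.factorial_ne_zero] using hφ
    · filter_upwards [hpow.eventually (hrow.eventually hdec),
        hpow.eventually (hne 0 (Nat.succ_pos _))] with s hs hs0
      simp only [h₁, add_zero] at hs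
      rw [hs, Finset.sum_range_succ', hs0]
      simp
  obtain ⟨k, m, hk, hm, w, hw, haw, hdvd, hwne, hw0⟩ := exists_newton_slope ha ha0 hne
  let h₂ : ℝ × ℝ → ℝ := fun z => ∑ j ∈ Finset.range (n' + 1), w j z.2 * z.1 ^ j +
    z.1 ^ (n' + 1) * u (z.2 ^ k * z.1, z.2 ^ m)
  let q : ℕ → ℝ := fun j => if j < n' + 1 then w j 0 else u 0
  let Q : Polynomial ℝ := ∑ j ∈ Finset.range (n' + 1 + 1), Polynomial.C (q j) * Polynomial.X ^ j
  have hQc : ∀ i, Q.coeff i = if i < n' + 1 + 1 then q i else 0 := fun i => by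
    simp [Q, Polynomial.finsetSum_coeff, Polynomial.coeff_C_mul, Polynomial.coeff_X_pow]
  have hQlt : ∀ i < n' + 1, Q.coeff i = w i 0 := fun i hi => by
    rw [hQc, if_pos (by omega)]
    simp only [q, if_pos hi]
  have hQn : Q.coeff (n' + 1) = u 0 := by simp [hQc, q]
  have hQdeg : Q.natDegree = n' + 1 :=
    Polynomial.natDegree_eq_of_le_of_coeff_ne_zero
      (Polynomial.natDegree_le_iff_coeff_eq_zero.2 fun i hi => by
        rw [hQc, if_neg (by omega)]) (by rwa [hQn])
  have hQeval : ∀ c, h₂ (c, 0) = Q.eval c := fun c => by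
    rw [Polynomial.eval_finsetSum, Finset.sum_range_succ]
    simp only [h₂, q, Polynomial.eval_mul, Polynomial.eval_C, Polynomial.eval_pow,
      Polynomial.eval_X, lt_irrefl, if_false, zero_pow hk.ne', zero_pow hm.ne', zero_mul]
    rw [mul_comm (c ^ (n' + 1))]
    refine congrArg₂ _ (Finset.sum_congr rfl fun j hj => ?_) rfl
    rw [if_pos (Finset.mem_range.1 hj)]
  obtain ⟨c, N, hNodd, hNn, hNdvd, hord⟩ := Polynomial.exists_odd_order_root (Q := Q) hm
    (by rwa [hQdeg]) (by
      rw [hQdeg]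
      intro j hj hjne
      exact hdvd j hj (by rwa [hQlt j hj] at hjne)) (by
      rw [hQdeg, Nat.add_sub_cancel, hQlt n' (Nat.lt_succ_self _)]
      exact hw0 n' (Nat.lt_succ_self _) hsub) (by
      rw [hQdeg]
      obtain ⟨j, hj, hjne⟩ := hwne
      exact ⟨j, hj, by rwa [hQlt j hj]⟩)
  rw [hQdeg] at hNn hNdvd
  let h₃ : ℝ × ℝ → ℝ := fun z => h₂ (c + z.1, z.2)
  have hh₂ : AnalyticAt ℝ h₂ (c, 0) := by
    have h1 : AnalyticAt ℝ (fun z : ℝ × ℝ => (z.2 ^ k * z.1, z.2 ^ m)) (c, 0) :=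
      ((analyticAt_snd.pow k).mul analyticAt_fst).prod (analyticAt_snd.pow m)
    have h2 : AnalyticAt ℝ (fun z : ℝ × ℝ => u (z.2 ^ k * z.1, z.2 ^ m)) (c, 0) := by
      refine AnalyticAt.comp (g := u) (f := fun z : ℝ × ℝ => (z.2 ^ k * z.1, z.2 ^ m)) ?_ h1
      rw [zero_pow hk.ne', zero_pow hm.ne', zero_mul]
      exact hu
    refine AnalyticAt.add (Finset.analyticAt_fun_sum _ fun j _ => ?_)
      ((analyticAt_fst.pow _).mul h2)
    exact (AnalyticAt.comp (g := w j) (f := fun z : ℝ × ℝ => z.2) (hw j) analyticAt_snd).mul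
      (analyticAt_fst.pow _)
  have hh₃ : AnalyticAt ℝ h₃ 0 := by
    refine AnalyticAt.comp (g := h₂) (f := fun z : ℝ × ℝ => (c + z.1, z.2)) ?_
      ((analyticAt_const.add analyticAt_fst).prod analyticAt_snd)
    simpa using hh₂
  have hord₃ : analyticOrderAt (fun b => h₃ (b, 0)) 0 = N := by
    have h1 : (fun b => h₃ (b, 0)) = (fun x => Q.eval x) ∘ fun b => c + b := by
      ext b
      exact hQeval (c + b)
    rw [h1, analyticOrderAt_comp_of_deriv_ne_zero (by fun_prop) (by simp)]
    simpa using hord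
  obtain ⟨γ, hγ, hγ0, hγev⟩ := ih N hNn hNodd hh₃ hord₃
  obtain ⟨d, hd⟩ := hNdvd
  have hd0 : d ≠ 0 := by
    rintro rfl
    exact Nat.factorial_ne_zero _ (hd.trans (mul_zero _))
  have hNd : d * N.factorial ≠ 0 := mul_ne_zero hd0 (Nat.factorial_ne_zero _)
  -- `e = s ^ (n' + 1)!`, `s₂ = e ^ (1 / m)` is the blown-up variable and `s ^ d` the new parameter
  have htend : ∀ i ≠ 0, Tendsto (fun s : ℝ => s ^ i) (𝓝 0) (𝓝 0) := fun i hi => by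
    have : ContinuousAt (fun s : ℝ => s ^ i) 0 := by fun_prop
    simpa [ContinuousAt, zero_pow hi] using this
  have hana : ∀ {f : ℝ → ℝ} (i : ℕ), i ≠ 0 → AnalyticAt ℝ f 0 →
      AnalyticAt ℝ (fun s => f (s ^ i)) 0 :=
    fun {f} i hi hf => by
      refine AnalyticAt.comp (g := f) (f := fun s : ℝ => s ^ i) ?_ (by fun_prop)
      simpa [zero_pow hi] using hf
  let b : ℝ → ℝ := fun s => (s ^ (d * N.factorial)) ^ k * (c + γ (s ^ d))
  have hb : AnalyticAt ℝ b 0 :=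
    ((analyticAt_id.pow _).pow _).mul (analyticAt_const.add (hana d hd0 hγ))
  have hb0 : b 0 = 0 := by simp [b, hNd, hk.ne']
  refine ⟨fun s => φ (s ^ (n' + 1).factorial) + b s,
    (hana _ (Nat.factorial_ne_zero _) hφ).add hb, by simp [hb0, hφ0, Nat.factorial_ne_zero], ?_⟩
  have hbt : Tendsto (fun s : ℝ => (b s, s ^ (n' + 1).factorial)) (𝓝 0) (𝓝 0) := by
    have h1 := hb.continuousAt.tendsto
    rw [hb0] at h1
    exact h1.prodMk_nhds (htend _ (Nat.factorial_ne_zero _))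
  have haw' : ∀ᶠ s in 𝓝 (0 : ℝ), ∀ j ∈ Finset.range (n' + 1),
      a j (s ^ m) = s ^ (k * (n' + 1 - j)) * w j s :=
    (Finset.eventually_all _).2 fun j hj => haw j (Finset.mem_range.1 hj)
  filter_upwards [hbt.eventually hdec, (htend _ hNd).eventually haw',
    (htend _ hd0).eventually hγev] with s hs1 hs2 hs3
  change h₁ (b s, s ^ (n' + 1).factorial) = 0
  rw [hs1]
  set s₂ := s ^ (d * N.factorial) with hs₂
  have he : s ^ (n' + 1).factorial = s₂ ^ m := by
    rw [hs₂, ← pow_mul, hd]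
    ring_nf
  have hs₃ : h₂ (c + γ (s ^ d), s₂) = 0 := by
    rw [← pow_mul] at hs3
    exact hs3
  rw [he]
  have hfinal : ∑ j ∈ Finset.range (n' + 1), a j (s₂ ^ m) * b s ^ j +
      b s ^ (n' + 1) * u (b s, s₂ ^ m) = s₂ ^ (k * (n' + 1)) * h₂ (c + γ (s ^ d), s₂) := by
    have hbs : b s = s₂ ^ k * (c + γ (s ^ d)) := rfl
    change _ = s₂ ^ (k * (n' + 1)) * (∑ j ∈ Finset.range (n' + 1), w j s₂ * (c + γ (s ^ d)) ^ j +
      (c + γ (s ^ d)) ^ (n' + 1) * u (s₂ ^ k * (c + γ (s ^ d)), s₂ ^ m))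
    rw [hbs]
    generalize c + γ (s ^ d) = x
    rw [mul_add (s₂ ^ (k * (n' + 1))), Finset.mul_sum]
    refine congrArg₂ _ (Finset.sum_congr rfl fun j hj => ?_) ?_
    · have hj' : k * (n' + 1) = k * (n' + 1 - j) + k * j := by
        rw [← mul_add, Nat.sub_add_cancel (Finset.mem_range.1 hj).le]
      rw [hs2 j hj, hj', pow_add, mul_pow, ← pow_mul]
      ring
    · rw [mul_pow, ← pow_mul]
      ring
  rw [hfinal, hs₃, mul_zero]

end Puiseux

/-! ### Lyapunov–Schmidt reduction of the periodic boundary value problem -/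

section Reduction

open Set
open scoped ContDiff

variable {T : ℝ}

/-- The curve `t ↦ (w t + x(t), A₀ + y(t), t + t₀)`, a perturbation by `z = (x, y)` of an unperturbed
trajectory of frequency `w`, over the time interval `[0, T]`. -/
noncomputable def perturbedCurve (w A₀ t₀ : ℝ) (z : C(Icc 0 T, ℝ) × C(Icc 0 T, ℝ)) :
    C(Icc 0 T, ℝ × ℝ × ℝ) :=
  ⟨fun t => (w * t + z.1 t, A₀ + z.2 t, t + t₀), by fun_prop⟩

theorem analyticAt_perturbedCurve (w A₀ t₀ : ℝ) (z : C(Icc 0 T, ℝ) × C(Icc 0 T, ℝ)) :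
    AnalyticAt ℝ (perturbedCurve w A₀ t₀) z := by
  have h : perturbedCurve (T := T) w A₀ t₀ = fun z => perturbedCurve w A₀ t₀ 0 +
      ((ContinuousLinearMap.inl ℝ ℝ (ℝ × ℝ)).compLeftContinuous ℝ (Icc 0 T) z.1 +
      ((ContinuousLinearMap.inr ℝ ℝ (ℝ × ℝ)) ∘L
        (ContinuousLinearMap.inl ℝ ℝ ℝ)).compLeftContinuous ℝ (Icc 0 T) z.2) := by
    ext z t <;> simp [perturbedCurve]
  rw [h]
  exact analyticAt_const.add (((ContinuousLinearMap.analyticAt _ _).comp analyticAt_fst).add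
    ((ContinuousLinearMap.analyticAt _ _).comp analyticAt_snd))

/-- The function `g` of `(α, A, t)` along the perturbed curve. -/
noncomputable def alongCurve (g : ℝ → ℝ → ℝ → ℝ) (w A₀ t₀ : ℝ)
    (z : C(Icc 0 T, ℝ) × C(Icc 0 T, ℝ)) : C(Icc 0 T, ℝ) :=
  superposition (fun v : ℝ × ℝ × ℝ => g v.1 v.2.1 v.2.2) (perturbedCurve w A₀ t₀ z)

variable {g : ℝ → ℝ → ℝ → ℝ} {W : Set ℝ} {w A₀ t₀ : ℝ} {z : C(Icc 0 T, ℝ) × C(Icc 0 T, ℝ)}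

theorem alongCurve_apply
    (hg : AnalyticOnNhd ℝ (fun x : ℝ × ℝ × ℝ => g x.1 x.2.1 x.2.2) {x | x.2.1 ∈ W})
    (hz : ∀ t, A₀ + z.2 t ∈ W) (t : Icc 0 T) :
    alongCurve g w A₀ t₀ z t = g (w * t + z.1 t) (A₀ + z.2 t) (t + t₀) :=
  superposition_apply (u := perturbedCurve w A₀ t₀ z)
    (f := fun v : ℝ × ℝ × ℝ => g v.1 v.2.1 v.2.2) (fun k => (hg _ (hz k)).continuousAt) t

theorem analyticAt_alongCurve
    (hg : AnalyticOnNhd ℝ (fun x : ℝ × ℝ × ℝ => g x.1 x.2.1 x.2.2) {x | x.2.1 ∈ W})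
    (hz : ∀ t, A₀ + z.2 t ∈ W) :
    AnalyticAt ℝ (alongCurve g w A₀ t₀) z :=
  (analyticAt_superposition (f := fun v : ℝ × ℝ × ℝ => g v.1 v.2.1 v.2.2)
    fun k => hg _ (hz k)).comp (analyticAt_perturbedCurve w A₀ t₀ z)

/-- The frequency as an analytic function of `(α, A, t)`. -/
theorem PlanarSystem.analytic_frequency (S : PlanarSystem) :
    AnalyticOnNhd ℝ (fun x : ℝ × ℝ × ℝ => (fun _ A _ => S.ω A) x.1 x.2.1 x.2.2)
      {x | x.2.1 ∈ S.W} := fun x hx =>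
  (S.analytic_ω x.2.1 hx).comp (f := fun x : ℝ × ℝ × ℝ => x.2.1)
    (analyticAt_fst.comp analyticAt_snd)

/-- The linearization of the frequency along an orbit: `(x, y) ↦ ω'(A₀) y`. -/
theorem PlanarSystem.fderiv_alongCurve_ω (S : PlanarSystem) (hA₀ : A₀ ∈ S.W)
    (z : C(Icc 0 T, ℝ) × C(Icc 0 T, ℝ)) :
    fderiv ℝ (alongCurve (fun _ A _ => S.ω A) w A₀ t₀) 0 z = deriv S.ω A₀ • z.2 := by
  ext t
  have han : AnalyticAt ℝ (alongCurve (T := T) (fun _ A _ => S.ω A) w A₀ t₀) 0 :=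
    analyticAt_alongCurve S.analytic_frequency (fun t => by simpa using hA₀)
  have h1 : HasDerivAt (fun s : ℝ => alongCurve (fun _ A _ => S.ω A) w A₀ t₀ (s • z))
      (fderiv ℝ (alongCurve (fun _ A _ => S.ω A) w A₀ t₀) 0 z) 0 := by
    have h2 : HasDerivAt (fun s : ℝ => s • z) z 0 := by
      simpa using (hasDerivAt_id (0 : ℝ)).smul_const z
    refine HasFDerivAt.comp_hasDerivAt (x := (0 : ℝ))
      (l := alongCurve (fun _ A _ => S.ω A) w A₀ t₀) (f := fun s : ℝ => s • z) ?_ h2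
    rw [zero_smul]
    exact han.differentiableAt.hasFDerivAt
  have h2 := (ContinuousMap.evalCLM ℝ t : C(Icc 0 T, ℝ) →L[ℝ] ℝ).hasFDerivAt.comp_hasDerivAt 0 h1
  have h3 : HasDerivAt (fun s : ℝ => S.ω (A₀ + s * z.2 t)) (deriv S.ω A₀ * z.2 t) 0 := by
    have h4 : HasDerivAt (fun s : ℝ => A₀ + s * z.2 t) (z.2 t) 0 := by
      simpa using ((hasDerivAt_id (0 : ℝ)).mul_const (z.2 t)).const_add A₀
    refine HasDerivAt.comp (h := fun s : ℝ => A₀ + s * z.2 t) (h₂ := S.ω) 0 ?_ h4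
    simpa using (S.analytic_ω A₀ hA₀).differentiableAt.hasDerivAt
  refine h2.unique (h3.congr_of_eventuallyEq ?_)
  have hc : Tendsto (fun s : ℝ => ‖s • z.2‖) (𝓝 0) (𝓝 0) := by
    have : ContinuousAt (fun s : ℝ => ‖s • z.2‖) 0 := by fun_prop
    simpa [ContinuousAt] using this
  obtain ⟨δ, hδ, hball⟩ := Metric.isOpen_iff.1 S.isOpen_W A₀ hA₀
  filter_upwards [hc.eventually_lt_const hδ] with s hs
  refine alongCurve_apply S.analytic_frequency (fun k => hball ?_) t
  rw [Metric.mem_ball, dist_eq_norm, add_sub_cancel_left]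
  exact ((s • z.2).norm_coe_le_norm k).trans_lt hs

/-- The right-hand side of the equation for the deviation of the angle from uniform rotation. -/
noncomputable def PlanarSystem.angleDefect (S : PlanarSystem) (A₀ t₀ ε : ℝ)
    (z : C(Icc 0 T, ℝ) × C(Icc 0 T, ℝ)) : C(Icc 0 T, ℝ) :=
  alongCurve (fun _ A _ => S.ω A) (S.ω A₀) A₀ t₀ z - ContinuousMap.const _ (S.ω A₀) +
    ε • alongCurve S.F (S.ω A₀) A₀ t₀ z

theorem primitive_const (hT : 0 ≤ T) (a : ℝ) (t : Icc 0 T) :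
    primitive hT (ContinuousMap.const _ a) t = t * a := by
  rw [primitive_apply hT _ (f := fun _ => a) (fun _ => rfl)]
  simp

/-- Lyapunov–Schmidt reduction. By the implicit function theorem, for every initial deviation `b` of
the angle and every small `ε` there are an initial action and functions `(x, y) = ψ (b, ε)` which
satisfy the integrated equations of motion on `[0, T]` and close up in the angle. Only the
periodicity of the action is left. -/
theorem PlanarSystem.exists_reduction (S : PlanarSystem) (hA₀ : A₀ ∈ S.W)
    (hω' : deriv S.ω A₀ ≠ 0) (t₀ : ℝ) (hT : 0 < T) :
    ∃ ψ : ℝ × ℝ → C(Icc 0 T, ℝ) × C(Icc 0 T, ℝ), AnalyticAt ℝ ψ 0 ∧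
      (∀ᶠ b in 𝓝 (0 : ℝ), ψ (b, 0) = (ContinuousMap.const _ b, 0)) ∧
      ∀ᶠ v : ℝ × ℝ in 𝓝 0,
        (ψ v).1 = ContinuousMap.const _ v.1 + primitive hT.le (S.angleDefect A₀ t₀ v.2 (ψ v)) ∧
        (∃ a : ℝ, (ψ v).2 = ContinuousMap.const _ a +
          v.2 • primitive hT.le (alongCurve S.G (S.ω A₀) A₀ t₀ (ψ v))) ∧
        primitive hT.le (S.angleDefect A₀ t₀ v.2 (ψ v)) ⟨T, hT.le, le_rfl⟩ = 0 := by
  let E := C(Icc 0 T, ℝ)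
  let J : E →L[ℝ] E := primitive hT.le
  let cst : ℝ →L[ℝ] E := ContinuousLinearMap.toSpanSingleton ℝ (ContinuousMap.const _ 1)
  have hcst : ∀ a : ℝ, cst a = ContinuousMap.const _ a := fun a => by
    ext t
    change a * 1 = a
    exact mul_one a
  let ev : E →L[ℝ] ℝ := ContinuousMap.evalCLM ℝ (⟨T, hT.le, le_rfl⟩ : Icc 0 T)
  let V : (ℝ × ℝ) × (E × E) × ℝ → E := fun u => S.angleDefect A₀ t₀ u.1.2 u.2.1
  let NG : E × E → E := alongCurve S.G (S.ω A₀) A₀ t₀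
  let Φ : (ℝ × ℝ) × (E × E) × ℝ → (E × E) × ℝ := fun u =>
    ((u.2.1.1 - cst u.1.1 - J (V u), u.2.1.2 - cst u.2.2 - u.1.2 • J (NG u.2.1)), ev (J (V u)))
  have hW0 : ∀ t : Icc 0 T, A₀ + (0 : E × E).2 t ∈ S.W := fun t => by
    change A₀ + 0 ∈ S.W
    rwa [add_zero]
  have hVV : ∀ {f : E × E → E}, AnalyticAt ℝ f 0 →
      AnalyticAt ℝ (fun u : (ℝ × ℝ) × (E × E) × ℝ => f u.2.1) 0 := fun {f} hf =>
    AnalyticAt.comp (g := f) (f := fun u : (ℝ × ℝ) × (E × E) × ℝ => u.2.1) hf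
      (analyticAt_fst.comp analyticAt_snd)
  have hε : AnalyticAt ℝ (fun u : (ℝ × ℝ) × (E × E) × ℝ => u.1.2) 0 :=
    analyticAt_snd.comp analyticAt_fst
  have hV : AnalyticAt ℝ V 0 :=
    ((hVV (analyticAt_alongCurve S.analytic_frequency hW0)).sub analyticAt_const).add
      (hε.smul (hVV (analyticAt_alongCurve S.analytic_F hW0)))
  have hJV : AnalyticAt ℝ (fun u => J (V u)) 0 := (J.analyticAt _).comp hV
  have hJG : AnalyticAt ℝ (fun u : (ℝ × ℝ) × (E × E) × ℝ => J (NG u.2.1)) 0 :=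
    (J.analyticAt _).comp (hVV (analyticAt_alongCurve S.analytic_G hW0))
  have hΦ : AnalyticAt ℝ Φ 0 := by
    refine AnalyticAt.prod (AnalyticAt.prod (AnalyticAt.sub (AnalyticAt.sub ?_ ?_) hJV)
      (AnalyticAt.sub (AnalyticAt.sub ?_ ?_) (hε.smul hJG))) ((ev.analyticAt _).comp hJV)
    · exact analyticAt_fst.comp (analyticAt_fst.comp analyticAt_snd)
    · exact (cst.analyticAt _).comp (analyticAt_fst.comp analyticAt_fst)
    · exact analyticAt_snd.comp (analyticAt_fst.comp analyticAt_snd)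
    · exact (cst.analyticAt _).comp (analyticAt_snd.comp analyticAt_snd)
  -- at `ε = 0` the uniform rotations with shifted phase solve the equations
  have hVb : ∀ b a : ℝ, V ((b, 0), (ContinuousMap.const _ b, 0), a) = 0 := fun b a => by
    ext t
    have : alongCurve (fun _ A _ => S.ω A) (S.ω A₀) A₀ t₀
        ((ContinuousMap.const _ b : C(Icc 0 T, ℝ)), (0 : C(Icc 0 T, ℝ))) t = S.ω A₀ := by
      rw [alongCurve_apply S.analytic_frequency (fun t => by simpa using hA₀)]
      simp
    simp [V, PlanarSystem.angleDefect, this]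
  have hΦb : ∀ b : ℝ, Φ ((b, 0), (ContinuousMap.const _ b, 0), 0) = 0 := fun b => by
    simp [Φ, hVb, hcst]
  have hΦ0 : Φ 0 = 0 := hΦb 0
  have hΦc : ContDiffAt ℝ ω Φ 0 := hΦ.contDiffAt
  -- the linearization at `ε = 0` is triangular
  have hlin : ∀ u : (E × E) × ℝ, (fderiv ℝ Φ 0 ∘L .inr ℝ (ℝ × ℝ) ((E × E) × ℝ)) u =
      ((u.1.1 - deriv S.ω A₀ • J u.1.2, u.1.2 - cst u.2), deriv S.ω A₀ * ev (J u.1.2)) := by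
    have hN : HasFDerivAt (fun u : (E × E) × ℝ => V (0, u))
        ((fderiv ℝ (alongCurve (fun _ A _ => S.ω A) (S.ω A₀) A₀ t₀) (0 : E × E)) ∘L
          (ContinuousLinearMap.fst ℝ (E × E) ℝ)) 0 := by
      have h1 : HasFDerivAt (fun u : (E × E) × ℝ =>
          alongCurve (fun _ A _ => S.ω A) (S.ω A₀) A₀ t₀ u.1) _ 0 :=
        HasFDerivAt.comp (f := fun u : (E × E) × ℝ => u.1) (x := 0)
          (analyticAt_alongCurve S.analytic_frequency hW0).differentiableAt.hasFDerivAt hasFDerivAt_fst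
      refine (h1.sub_const (ContinuousMap.const _ (S.ω A₀))).congr_of_eventuallyEq
        (Eventually.of_forall fun u => ?_)
      simp [V, PlanarSystem.angleDefect]
    have hJN := (J.hasFDerivAt (x := V (0, 0))).comp (f := fun u : (E × E) × ℝ => V (0, u))
      (0 : (E × E) × ℝ) hN
    have h2 : HasFDerivAt (fun u : (E × E) × ℝ => Φ (0, u)) _ 0 :=
      ((((ContinuousLinearMap.fst ℝ E E) ∘L (ContinuousLinearMap.fst ℝ (E × E) ℝ)).hasFDerivAt.sub
        hJN).prodMk
      ((((ContinuousLinearMap.snd ℝ E E) ∘L (ContinuousLinearMap.fst ℝ (E × E) ℝ)) -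
        cst ∘L (ContinuousLinearMap.snd ℝ (E × E) ℝ)).hasFDerivAt)).prodMk
      (ev.hasFDerivAt.comp (0 : (E × E) × ℝ) hJN) |>.congr_of_eventuallyEq
        (Eventually.of_forall fun u => by simp [Φ])
    have h3 : HasFDerivAt (fun u : (E × E) × ℝ => Φ (0, u))
        (fderiv ℝ Φ 0 ∘L .inr ℝ (ℝ × ℝ) ((E × E) × ℝ)) 0 :=
      HasFDerivAt.comp (x := (0 : (E × E) × ℝ)) (g := Φ)
        (f := fun u : (E × E) × ℝ => ((0 : ℝ × ℝ), u)) hΦ.differentiableAt.hasFDerivAt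
        (ContinuousLinearMap.inr ℝ (ℝ × ℝ) ((E × E) × ℝ)).hasFDerivAt
    intro u
    rw [h3.unique h2]
    simp [S.fderiv_alongCurve_ω hA₀]
  have hevJ : ∀ a, ev (J (cst a)) = T * a := fun a => by
    rw [hcst]
    exact primitive_const hT.le a _
  have hinv : (fderiv ℝ Φ 0 ∘L .inr ℝ (ℝ × ℝ) ((E × E) × ℝ)).IsInvertible := by
    refine ⟨ContinuousLinearEquiv.ofBijective _ (LinearMap.ker_eq_bot'.2 fun u hu => ?_)
      (LinearMap.range_eq_top.2 fun v => ?_), ContinuousLinearEquiv.coe_ofBijective _ _ _⟩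
    · have hu' := (hlin u).symm.trans hu
      obtain ⟨⟨x, y⟩, a⟩ := u
      simp only [Prod.mk_eq_zero] at hu'
      obtain ⟨⟨hx, hy⟩, ha⟩ := hu'
      rw [sub_eq_zero] at hx hy
      subst hy
      rw [hevJ] at ha
      have ha0 : a = 0 := by simpa [hω', hT.ne'] using ha
      subst ha0
      simp [hx]
    · obtain ⟨⟨f, k⟩, c⟩ := v
      let a : ℝ := (c / deriv S.ω A₀ - ev (J k)) / T
      refine ⟨((f + deriv S.ω A₀ • J (k + cst a), k + cst a), a), (hlin _).trans ?_⟩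
      have h1 : deriv S.ω A₀ * ev (J (k + cst a)) = c := by
        rw [map_add, map_add, hevJ, mul_div_cancel₀ _ hT.ne']
        field_simp
        ring
      exact Prod.ext (Prod.ext (add_sub_cancel_right _ _) (add_sub_cancel_right _ _)) h1
  have hψ := (hΦc.contDiffAt_implicitFunction (by simp) hinv).analyticAt
  have hψ0 := hΦc.implicitFunction_apply_self (by simp) hinv
  have hψΦ := hΦc.eventually_apply_implicitFunction (by simp) hinv
  have hψu := hΦc.eventually_apply_eq_iff_implicitFunction (by simp) hinv
  set Ψ := hΦc.implicitFunction (by simp) hinv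
  refine ⟨fun v => (Ψ v).1, analyticAt_fst.comp hψ, ?_, ?_⟩
  · have hc : Tendsto (fun b : ℝ => (((b, 0), (cst b, 0), 0) : (ℝ × ℝ) × (E × E) × ℝ))
        (𝓝 0) (𝓝 0) := by
      have : ContinuousAt
          (fun b : ℝ => (((b, 0), (cst b, 0), 0) : (ℝ × ℝ) × (E × E) × ℝ)) 0 := by fun_prop
      rw [ContinuousAt, map_zero] at this
      exact this
    filter_upwards [hc.eventually hψu] with b hb
    have := hb.1 (by rw [hcst, hΦb, hΦ0])
    rw [this, hcst]
  · filter_upwards [hψΦ] with v hv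
    rw [hΦ0] at hv
    simp only [Φ, Prod.mk_eq_zero] at hv
    obtain ⟨⟨hx, hy⟩, ha⟩ := hv
    rw [sub_sub, sub_eq_zero, hcst] at hx hy
    exact ⟨hx, ⟨_, hy⟩, ha⟩

end Reduction

/-! ### Periodic extension -/

section PeriodicExtension

open Set

variable {T : ℝ}

/-- The `T`-periodic function on `ℝ` that agrees with `x` on `[0, T)`. -/
noncomputable def periodicExt (hT : 0 < T) (x : C(Icc 0 T, ℝ)) (t : ℝ) : ℝ :=
  x ⟨toIcoMod hT 0 t, by
    have h := toIcoMod_mem_Ico' hT t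
    exact ⟨h.1, h.2.le⟩⟩

theorem periodicExt_periodic (hT : 0 < T) (x : C(Icc 0 T, ℝ)) :
    Function.Periodic (periodicExt hT x) T := fun t => by
  simp [periodicExt]

theorem abs_periodicExt_le (hT : 0 < T) (x : C(Icc 0 T, ℝ)) (t : ℝ) :
    |periodicExt hT x t| ≤ ‖x‖ :=
  x.norm_coe_le_norm _

theorem periodicExt_apply (hT : 0 < T) {x : C(Icc 0 T, ℝ)}
    (hx : x ⟨0, le_rfl, hT.le⟩ = x ⟨T, hT.le, le_rfl⟩) (t : Icc 0 T) :
    periodicExt hT x t = x t := by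
  obtain ⟨t, ht⟩ := t
  rcases ht.2.lt_or_eq with h | rfl
  · have h1 : toIcoMod hT 0 t = t := (toIcoMod_eq_self hT).2 ⟨ht.1, by simpa using h⟩
    simp only [periodicExt, h1]
  · have h1 : toIcoMod hT 0 t = 0 := by simpa using toIcoMod_apply_right hT 0
    simp only [periodicExt, h1]
    exact hx

/-- Two `T`-periodic functions agree if they agree on `[0, T]`. -/
theorem Function.Periodic.eq_of_eq_on_Icc {f g : ℝ → ℝ} (hT : 0 < T) (hf : Function.Periodic f T)
    (hg : Function.Periodic g T) (h : ∀ t : Icc 0 T, f t = g t) : f = g := by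
  ext t
  obtain ⟨s, hs, hst⟩ := (show Function.Periodic (fun t => f t - g t) T from fun t => by
    simp only [hf t, hg t]).exists_mem_Ico₀ hT t
  have := h ⟨s, hs.1, hs.2.le⟩
  simp only at hst this
  linarith

/-- If `x` is a primitive on `[0, T]` of a periodic function with zero mean, then its periodic
extension is a primitive on `ℝ`, also at the multiples of `T` where the pieces are joined. -/
theorem hasDerivAt_periodicExt (hT : 0 < T) {x : C(Icc 0 T, ℝ)} {v : ℝ → ℝ} (hv : Continuous v)
    (hper : Function.Periodic v T) (h0 : ∫ s in (0 : ℝ)..T, v s = 0) {b : ℝ}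
    (hx : ∀ t : Icc 0 T, x t = b + ∫ s in (0 : ℝ)..t, v s) (t : ℝ) :
    HasDerivAt (periodicExt hT x) (v t) t := by
  have hint : ∀ a c, IntervalIntegrable v MeasureTheory.volume a c := fun a c =>
    hv.intervalIntegrable a c
  have heq : periodicExt hT x = fun t => b + ∫ s in (0 : ℝ)..t, v s := by
    refine (periodicExt_periodic hT x).eq_of_eq_on_Icc hT (fun t => ?_) fun t => ?_
    · have h1 := intervalIntegral.integral_add_adjacent_intervals (hint 0 t) (hint t (t + T))
      have h2 := hper.intervalIntegral_add_eq t 0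
      rw [zero_add, h0] at h2
      simp only [← h1, h2, add_zero]
    · rw [periodicExt_apply hT _ t, hx]
      simp [hx, h0]
  rw [heq]
  exact (intervalIntegral.integral_hasDerivAt_right (hint 0 t)
    hv.aestronglyMeasurable.stronglyMeasurableAtFilter hv.continuousAt).const_add b

theorem continuous_periodicExt (hT : 0 < T) {x : C(Icc 0 T, ℝ)}
    (hx : x ⟨0, le_rfl, hT.le⟩ = x ⟨T, hT.le, le_rfl⟩) : Continuous (periodicExt hT x) := by
  have : Fact (0 < T) := ⟨hT⟩
  have h1 : Continuous (AddCircle.liftIco T 0 (IccExtend hT.le x)) := by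
    refine AddCircle.liftIco_zero_continuous ?_ x.continuous.Icc_extend'.continuousOn
    rw [IccExtend_of_mem hT.le _ ⟨le_rfl, hT.le⟩, IccExtend_of_mem hT.le _ ⟨hT.le, le_rfl⟩, hx]
  have h2 : periodicExt hT x =
      fun t : ℝ => AddCircle.liftIco T 0 (IccExtend hT.le x) (t : AddCircle T) := by
    refine (periodicExt_periodic hT x).eq_of_eq_on_Icc hT (fun t => ?_) fun t => ?_
    · simp
    · rw [periodicExt_apply hT hx t]
      rcases t.2.2.lt_or_eq with h | h
      · rw [AddCircle.liftIco_coe_apply ⟨t.2.1, by simpa using h⟩, IccExtend_of_mem hT.le _ t.2]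
      · have h3 : ((t : ℝ) : AddCircle T) = ((0 : ℝ) : AddCircle T) := by
          rw [h]; simp
        rw [h3, AddCircle.liftIco_coe_apply ⟨le_rfl, by simpa using hT⟩,
          IccExtend_of_mem hT.le _ ⟨le_rfl, hT.le⟩, hx]
        congr 1
        exact Subtype.ext h
  rw [h2]
  exact h1.comp (AddCircle.continuous_mk' T)

end PeriodicExtension

/-! ### Subharmonic solutions -/

section Subharmonic

open Set

theorem PlanarSystem.periodic_of_angle_time {g : ℝ → ℝ → ℝ → ℝ} {W : Set ℝ}
    (hα : ∀ α t : ℝ, ∀ A ∈ W, g (α + 2 * Real.pi) A t = g α A t)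
    (ht : ∀ α t : ℝ, ∀ A ∈ W, g α A (t + 2 * Real.pi) = g α A t) {A : ℝ} (hA : A ∈ W)
    (p : ℤ) (q : ℕ) (α t : ℝ) :
    g (α + 2 * Real.pi * p) A (t + 2 * Real.pi * q) = g α A t := by
  have h1 : Function.Periodic (fun α => g α A (t + 2 * Real.pi * q)) (2 * Real.pi) :=
    fun α => hα α _ A hA
  have h2 : Function.Periodic (fun t => g α A t) (2 * Real.pi) := fun t => ht α t A hA
  have h3 := h1.int_mul p α
  have h4 := h2.nat_mul q t
  rw [mul_comm] at h3 h4
  exact h3.trans h4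

variable {S : PlanarSystem} {A₀ t₀ : ℝ} {p : ℤ} {q : ℕ}

/-- A solution of the integrated equations on `[0, T]` that closes up extends to a periodic solution
for all times. -/
theorem PlanarSystem.isSolution_periodicExt (hT : 0 < 2 * Real.pi * q)
    (hpq : S.ω A₀ * (2 * Real.pi * q) = 2 * Real.pi * p) {ε b a : ℝ}
    {z : C(Icc 0 (2 * Real.pi * q), ℝ) × C(Icc 0 (2 * Real.pi * q), ℝ)}
    (hz : ∀ t, A₀ + z.2 t ∈ S.W)
    (hx : z.1 = ContinuousMap.const _ b + primitive hT.le (S.angleDefect A₀ t₀ ε z))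
    (hy : z.2 = ContinuousMap.const _ a +
      ε • primitive hT.le (alongCurve S.G (S.ω A₀) A₀ t₀ z))
    (hx0 : primitive hT.le (S.angleDefect A₀ t₀ ε z) ⟨_, hT.le, le_rfl⟩ = 0)
    (hy0 : primitive hT.le (alongCurve S.G (S.ω A₀) A₀ t₀ z) ⟨_, hT.le, le_rfl⟩ = 0) :
    S.IsSolution ε t₀ (fun t => S.ω A₀ * t + periodicExt hT z.1 t)
      (fun t => A₀ + periodicExt hT z.2 t) := by
  have hprim0 : ∀ u, primitive hT.le u ⟨0, le_rfl, hT.le⟩ = 0 := fun u => by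
    simp [primitive]
  have hx1 : z.1 ⟨0, le_rfl, hT.le⟩ = z.1 ⟨_, hT.le, le_rfl⟩ := by
    rw [hx, ContinuousMap.add_apply, ContinuousMap.add_apply, hprim0, hx0]
    rfl
  have hy1 : z.2 ⟨0, le_rfl, hT.le⟩ = z.2 ⟨_, hT.le, le_rfl⟩ := by
    rw [hy, ContinuousMap.add_apply, ContinuousMap.add_apply, ContinuousMap.smul_apply,
      ContinuousMap.smul_apply, hprim0, hy0]
    rfl
  set X := periodicExt hT z.1
  set Y := periodicExt hT z.2
  have hXc : Continuous X := continuous_periodicExt hT hx1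
  have hYc : Continuous Y := continuous_periodicExt hT hy1
  have hXp := periodicExt_periodic hT z.1
  have hYp := periodicExt_periodic hT z.2
  have hYW : ∀ t, A₀ + Y t ∈ S.W := fun t => hz _
  -- the coefficient functions along the extended curve are continuous and periodic
  have key : ∀ g : ℝ → ℝ → ℝ → ℝ,
      AnalyticOnNhd ℝ (fun x : ℝ × ℝ × ℝ => g x.1 x.2.1 x.2.2) {x | x.2.1 ∈ S.W} →
      (∀ α t : ℝ, ∀ A ∈ S.W, g (α + 2 * Real.pi) A t = g α A t) →
      (∀ α t : ℝ, ∀ A ∈ S.W, g α A (t + 2 * Real.pi) = g α A t) →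
      Continuous (fun t => g (S.ω A₀ * t + X t) (A₀ + Y t) (t + t₀)) ∧
      Function.Periodic (fun t => g (S.ω A₀ * t + X t) (A₀ + Y t) (t + t₀)) (2 * Real.pi * q) ∧
      ∀ t : Icc 0 (2 * Real.pi * q), alongCurve g (S.ω A₀) A₀ t₀ z t =
        g (S.ω A₀ * t + X t) (A₀ + Y t) (t + t₀) := by
    intro g hg hgα hgt
    refine ⟨continuous_iff_continuousAt.2 fun t => ?_, fun t => ?_, fun t => ?_⟩
    · exact ContinuousAt.comp (g := fun x : ℝ × ℝ × ℝ => g x.1 x.2.1 x.2.2)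
        (f := fun t => (S.ω A₀ * t + X t, A₀ + Y t, t + t₀))
        (hg _ (hYW t)).continuousAt (by fun_prop)
    · simp only [X, Y]
      rw [hXp t, hYp t, mul_add, hpq, add_right_comm, add_right_comm t]
      exact PlanarSystem.periodic_of_angle_time hgα hgt (hYW t) p q _ _
    · rw [alongCurve_apply hg hz]
      simp only [X, Y]
      rw [periodicExt_apply hT hx1, periodicExt_apply hT hy1]
  obtain ⟨hωc, hωp, hωe⟩ := key (fun _ A _ => S.ω A) S.analytic_frequency (fun _ _ _ _ => rfl)
    (fun _ _ _ _ => rfl)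
  obtain ⟨hFc, hFp, hFe⟩ := key S.F S.analytic_F S.periodic_F_angle S.periodic_F_time
  obtain ⟨hGc, hGp, hGe⟩ := key S.G S.analytic_G S.periodic_G_angle S.periodic_G_time
  let vX : ℝ → ℝ := fun t => (S.ω (A₀ + Y t) - S.ω A₀) +
    ε * S.F (S.ω A₀ * t + X t) (A₀ + Y t) (t + t₀)
  let vY : ℝ → ℝ := fun t => ε * S.G (S.ω A₀ * t + X t) (A₀ + Y t) (t + t₀)
  have hdef : ∀ t : Icc 0 (2 * Real.pi * q), S.angleDefect A₀ t₀ ε z t = vX t := fun t => by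
    simp [PlanarSystem.angleDefect, hωe, hFe, vX]
  have hXd := hasDerivAt_periodicExt hT (x := z.1) (b := b) (v := vX)
    ((hωc.sub continuous_const).add (continuous_const.mul hFc))
    (fun t => by
      have h1 := hωp t
      have h2 := hFp t
      simp only at h1 h2
      simp only [vX, h1, h2])
    ((primitive_apply hT.le _ hdef ⟨_, hT.le, le_rfl⟩).symm.trans hx0)
    (fun t => by
      rw [← primitive_apply hT.le _ hdef]
      conv_lhs => rw [hx]
      rfl)
  have hGe' : ∀ t : Icc 0 (2 * Real.pi * q), (ε • alongCurve S.G (S.ω A₀) A₀ t₀ z) t =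
      vY t := fun t => by
    simp [hGe, vY]
  have hYd := hasDerivAt_periodicExt hT (x := z.2) (b := a) (v := vY)
    (continuous_const.mul hGc)
    (fun t => by
      have h2 := hGp t
      simp only at h2
      simp only [vY, h2])
    (by
      rw [← primitive_apply hT.le _ hGe' ⟨_, hT.le, le_rfl⟩, map_smul, ContinuousMap.smul_apply,
        hy0, smul_zero])
    (fun t => by
      rw [← primitive_apply hT.le _ hGe', map_smul]
      conv_lhs => rw [hy]
      rfl)
  intro t
  refine ⟨hYW t, ?_, ?_⟩
  · have h := ((hasDerivAt_id t).const_mul (S.ω A₀)).add (hXd t)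
    exact h.congr_deriv (by simp only [vX, mul_one]; ring)
  · exact (hYd t).const_add A₀

/-- Shifting the angle of the unperturbed trajectory by `b` amounts to shifting time by
`-b / ω(A₀)`. -/
theorem PlanarSystem.integral_eq_melnikov (hA₀ : A₀ ∈ S.W) (hT : 0 < 2 * Real.pi * q)
    (hpq : S.ω A₀ * (2 * Real.pi * q) = 2 * Real.pi * p) (hω0 : S.ω A₀ ≠ 0) (b : ℝ) :
    ∫ t in (0 : ℝ)..(2 * Real.pi * q), S.G (S.ω A₀ * t + b) A₀ (t + t₀) =
      2 * Real.pi * q * S.melnikov A₀ q (t₀ - b / S.ω A₀) := by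
  set s := -(b / S.ω A₀)
  have hper : Function.Periodic (fun t => S.G (S.ω A₀ * t + b) A₀ (t + t₀)) (2 * Real.pi * q) :=
    fun t => by
      change S.G (S.ω A₀ * (t + 2 * Real.pi * q) + b) A₀ (t + 2 * Real.pi * q + t₀) =
        S.G (S.ω A₀ * t + b) A₀ (t + t₀)
      rw [mul_add, hpq, add_right_comm, add_right_comm t]
      exact PlanarSystem.periodic_of_angle_time S.periodic_G_angle S.periodic_G_time hA₀ p q _ _
  have h1 := hper.intervalIntegral_add_eq 0 s
  rw [zero_add] at h1
  rw [h1, PlanarSystem.melnikov, ← mul_assoc, mul_one_div_cancel hT.ne', one_mul, add_comm s,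
    ← zero_add s, ← add_assoc, add_zero]
  rw [← intervalIntegral.integral_comp_add_right (fun t => S.G (S.ω A₀ * t + b) A₀ (t + t₀)) s]
  refine intervalIntegral.integral_congr fun t _ => ?_
  have h2 : S.ω A₀ * (t + s) + b = S.ω A₀ * t := by
    simp only [s]
    field_simp
    ring
  simp only [h2]
  congr 1
  simp only [s]
  ring

theorem PlanarSystem.melnikov_eq_of_ω_eq_zero (hA₀ : A₀ ∈ S.W) (hω0 : S.ω A₀ = 0) (t : ℝ) :
    S.melnikov A₀ q t = S.melnikov A₀ q 0 := by
  have hper : Function.Periodic (fun t => S.G 0 A₀ t) (2 * Real.pi * q) := fun t => by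
    simpa using PlanarSystem.periodic_of_angle_time S.periodic_G_angle S.periodic_G_time hA₀ 0 q 0 t
  simp only [PlanarSystem.melnikov, hω0, zero_mul, add_zero]
  rw [intervalIntegral.integral_comp_add_right (fun t => S.G 0 A₀ t), zero_add, add_comm _ t,
    hper.intervalIntegral_add_eq t 0, zero_add]

end Subharmonic

/-! ### Fractional power series of the subharmonic solutions -/

section Expansion

open Set

theorem AnalyticAt.exists_hasSum_pow_smul {E : Type*} [NormedAddCommGroup E] [NormedSpace ℝ E]
    {f : ℝ → E} (hf : AnalyticAt ℝ f 0) (hf0 : f 0 = 0) :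
    ∃ r > (0 : ℝ), ∃ (C : ℝ) (c : ℕ → E), c 0 = 0 ∧ (∀ k, ‖c k‖ * r ^ k ≤ C) ∧
      ∀ s : ℝ, |s| < r → HasSum (fun k => s ^ k • c k) (f s) := by
  obtain ⟨P, R, hP⟩ := hf
  obtain ⟨r, hr0, hr⟩ := ENNReal.lt_iff_exists_nnreal_btwn.1 hP.r_pos
  obtain ⟨C, -, hC⟩ := P.norm_mul_pow_le_of_lt_radius (hr.trans_le hP.r_le)
  refine ⟨r, by exact_mod_cast hr0, C, P.coeff, ?_, fun k => ?_, fun s hs => ?_⟩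
  · rw [← hf0, ← hP.coeff_zero 1]
    rfl
  · rw [← FormalMultilinearSeries.norm_apply_eq_norm_coef]
    exact hC k
  · have h := hP.hasSum (y := s) (by
      rw [mem_eball_zero_iff]
      refine lt_trans ?_ hr
      rw [← ofReal_norm, Real.norm_eq_abs]
      exact (ENNReal.ofReal_lt_iff_lt_toReal (abs_nonneg s) ENNReal.coe_ne_top).2 hs)
    simpa using h

/-- A convergent power series with coefficients in `C([0, T])` gives a fractional expansion of its
periodic extension, because evaluation at a time is a bounded functional of norm at most one. -/
theorem hasFractionalExpansion_periodicExt {T : ℝ} (hT : 0 < T) {N : ℕ} {x : ℝ → C(Icc 0 T, ℝ)}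
    {r C : ℝ} {c : ℕ → C(Icc 0 T, ℝ)} (hr : 0 < r) (hc0 : c 0 = 0)
    (hC : ∀ k, ‖c k‖ * r ^ k ≤ C) (hsum : ∀ s : ℝ, |s| < r → HasSum (fun k => s ^ k • c k) (x s))
    {D : Set ℝ} (hD : ∀ ε ∈ D, |ε| ^ (1 / (N : ℝ)) < r) {u : ℝ → ℝ → ℝ}
    (hu : ∀ ε ∈ D, ∀ t, u ε t = periodicExt hT (x (|ε| ^ (1 / (N : ℝ)))) t) :
    HasFractionalExpansion N T D u := by
  refine ⟨fun k => periodicExt hT (c k), fun k t => periodicExt_periodic hT (c k) t, fun t => ?_,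
    ⟨r, C, hr, hD, fun k t => ?_⟩, fun ε hε t => ?_⟩
  · simp [periodicExt, hc0]
  · exact (mul_le_mul_of_nonneg_right (abs_periodicExt_le hT (c k) t) (by positivity)).trans (hC k)
  · rw [hu ε hε t]
    have h := hsum (|ε| ^ (1 / (N : ℝ))) (by rw [abs_of_nonneg (by positivity)]; exact hD ε hε)
    have h2 := (ContinuousMap.evalCLM ℝ (⟨toIcoMod hT 0 t, by
      have h := toIcoMod_mem_Ico' hT t
      exact ⟨h.1, h.2.le⟩⟩ : Icc 0 T) : C(Icc 0 T, ℝ) →L[ℝ] ℝ).hasSum h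
    refine h2.congr_fun fun k => ?_
    simp [periodicExt, mul_comm]

variable {S : PlanarSystem} {A₀ t₀ : ℝ} {p : ℤ} {q n : ℕ}

/-- A resonance with `ω(A₀) = 0` is excluded: its Melnikov function is constant. -/
theorem PlanarSystem.ω_ne_zero_of_isZeroOfOrder (hA₀ : A₀ ∈ S.W) (hn : n ≠ 0)
    (hM : IsZeroOfOrder (S.melnikov A₀ q) n t₀) : S.ω A₀ ≠ 0 := fun h0 => by
  have h1 : S.melnikov A₀ q = fun _ => S.melnikov A₀ q 0 :=
    funext (PlanarSystem.melnikov_eq_of_ω_eq_zero hA₀ h0)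
  have h2 := hM.2
  rw [h1, iteratedDeriv_const, if_neg hn] at h2
  exact h2 rfl

/-- An analytic branch of subharmonic solutions, parametrized by `s = (σ ε) ^ (1 / n!)`. -/
theorem PlanarSystem.exists_subharmonic_branch (hA₀ : A₀ ∈ S.W) (hT : 0 < 2 * Real.pi * q)
    (hpq : S.ω A₀ * (2 * Real.pi * q) = 2 * Real.pi * p) (hω' : deriv S.ω A₀ ≠ 0) (hn : Odd n)
    (hM : IsZeroOfOrder (S.melnikov A₀ q) n t₀) (σ : ℝ) :
    ∃ X : ℝ → C(Icc 0 (2 * Real.pi * q), ℝ) × C(Icc 0 (2 * Real.pi * q), ℝ),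
      AnalyticAt ℝ X 0 ∧ X 0 = 0 ∧ ∀ᶠ s in 𝓝 (0 : ℝ), S.IsSolution (σ * s ^ n.factorial) t₀
        (fun t => S.ω A₀ * t + periodicExt hT (X s).1 t)
        (fun t => A₀ + periodicExt hT (X s).2 t) := by
  have hω0 := PlanarSystem.ω_ne_zero_of_isZeroOfOrder hA₀ hn.pos.ne' hM
  obtain ⟨ψ, hψ, hψ0, hψev⟩ := S.exists_reduction hA₀ hω' t₀ hT
  have hψ00 : ψ 0 = 0 := hψ0.self_of_nhds
  -- the bifurcation function
  let h : ℝ × ℝ → ℝ := fun v =>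
    primitive hT.le (alongCurve S.G (S.ω A₀) A₀ t₀ (ψ v)) ⟨_, hT.le, le_rfl⟩
  have hh : AnalyticAt ℝ h 0 := by
    refine ((ContinuousMap.evalCLM ℝ (⟨_, hT.le, le_rfl⟩ : Icc 0 (2 * Real.pi * q)) ∘L
      primitive hT.le : C(Icc 0 (2 * Real.pi * q), ℝ) →L[ℝ] ℝ).analyticAt _).comp ?_
    refine AnalyticAt.comp (g := alongCurve S.G (S.ω A₀) A₀ t₀) ?_ hψ
    rw [hψ00]
    refine analyticAt_alongCurve S.analytic_G fun t => ?_
    change A₀ + 0 ∈ S.W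
    rwa [add_zero]
  have hh0 : (fun b => h (b, 0)) =ᶠ[𝓝 0] fun b =>
      2 * Real.pi * q * S.melnikov A₀ q (t₀ - b / S.ω A₀) := by
    filter_upwards [hψ0] with b hb
    rw [← PlanarSystem.integral_eq_melnikov hA₀ hT hpq hω0 b]
    refine primitive_apply hT.le _ (f := fun t => S.G (S.ω A₀ * t + b) A₀ (t + t₀)) (fun t => ?_) _
    rw [hb, alongCurve_apply S.analytic_G (fun t => by simpa using hA₀)]
    simp
  have hrow : AnalyticAt ℝ (fun b : ℝ => h (b, 0)) 0 :=
    AnalyticAt.comp (g := h) (f := fun b : ℝ => (b, (0 : ℝ))) hh (by fun_prop)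
  have hord : analyticOrderAt (fun b => h (b, 0)) 0 = n := by
    have hmel : S.melnikov A₀ q =ᶠ[𝓝 t₀]
        fun t => (2 * Real.pi * q)⁻¹ * h (S.ω A₀ * (t₀ - t), 0) := by
      have hc : Tendsto (fun t => S.ω A₀ * (t₀ - t)) (𝓝 t₀) (𝓝 0) := by
        have : ContinuousAt (fun t => S.ω A₀ * (t₀ - t)) t₀ := by fun_prop
        simpa [ContinuousAt] using this
      filter_upwards [hc.eventually hh0] with t ht
      rw [ht, inv_mul_cancel_left₀ hT.ne', mul_div_cancel_left₀ _ hω0, sub_sub_cancel]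
    have hmelan : AnalyticAt ℝ (S.melnikov A₀ q) t₀ := by
      refine AnalyticAt.congr ?_ hmel.symm
      refine analyticAt_const.mul (AnalyticAt.comp (g := fun b => h (b, 0))
        (f := fun t => S.ω A₀ * (t₀ - t)) ?_ (by fun_prop))
      simpa using hrow
    have hmelord := (analyticOrderAt_eq_nat_iff_iteratedDeriv_eq_zero hmelan).2 hM
    rw [analyticOrderAt_congr hh0]
    have h1 : (fun b => 2 * Real.pi * q * S.melnikov A₀ q (t₀ - b / S.ω A₀)) =
        (fun _ => 2 * Real.pi * q) * (S.melnikov A₀ q ∘ fun b => t₀ - b / S.ω A₀) := rfl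
    have hg : AnalyticAt ℝ (fun b => t₀ - b / S.ω A₀) 0 := by fun_prop (disch := assumption)
    have hg' : deriv (fun b => t₀ - b / S.ω A₀) 0 ≠ 0 := by
      have : HasDerivAt (fun b => t₀ - b / S.ω A₀) (-(1 / S.ω A₀)) 0 :=
        ((hasDerivAt_id (0 : ℝ)).div_const _).const_sub _
      rw [this.deriv]
      simpa using hω0
    have hcomp : AnalyticAt ℝ (S.melnikov A₀ q ∘ fun b => t₀ - b / S.ω A₀) 0 :=
      AnalyticAt.comp (by simpa using hmelan) hg
    rw [h1, analyticOrderAt_mul analyticAt_const hcomp,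
      (analyticAt_const.analyticOrderAt_eq_zero).2 hT.ne', zero_add,
      analyticOrderAt_comp_of_deriv_ne_zero hg hg']
    simpa using hmelord
  let hσ : ℝ × ℝ → ℝ := fun v => h (v.1, σ * v.2)
  have hσan : AnalyticAt ℝ hσ 0 := by
    refine AnalyticAt.comp (g := h) (f := fun v : ℝ × ℝ => (v.1, σ * v.2)) ?_
      (analyticAt_fst.prod (analyticAt_const.mul analyticAt_snd))
    change AnalyticAt ℝ h (0, σ * 0)
    rw [mul_zero]
    exact hh
  obtain ⟨b, hb, hb0, hbev⟩ := exists_puiseux_branch hn hσan (by simpa [hσ] using hord)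
  let P : ℝ → ℝ × ℝ := fun s => (b s, σ * s ^ n.factorial)
  have hP : AnalyticAt ℝ P 0 := hb.prod (by fun_prop)
  have hP0 : P 0 = 0 := by simp [P, hb0, Nat.factorial_ne_zero]
  have hX : AnalyticAt ℝ (fun s => ψ (P s)) 0 := AnalyticAt.comp (by rwa [hP0]) hP
  have hX0 : ψ (P 0) = 0 := by rw [hP0, hψ00]
  refine ⟨fun s => ψ (P s), hX, hX0, ?_⟩
  have hPt : Tendsto P (𝓝 0) (𝓝 0) := by
    have := hP.continuousAt.tendsto
    rwa [hP0] at this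
  have hnorm : Tendsto (fun s => ‖(ψ (P s)).2‖) (𝓝 0) (𝓝 0) := by
    have := (hX.continuousAt.snd.norm).tendsto
    simpa [hX0] using this
  obtain ⟨δ, hδ, hball⟩ := Metric.isOpen_iff.1 S.isOpen_W A₀ hA₀
  filter_upwards [hPt.eventually hψev, hbev, hnorm.eventually_lt_const hδ] with s hs1 hs2 hs3
  obtain ⟨hx, ⟨a, hy⟩, hx0⟩ := hs1
  refine PlanarSystem.isSolution_periodicExt hT hpq (fun t => hball ?_) hx hy hx0 hs2
  rw [Metric.mem_ball, dist_eq_norm, add_sub_cancel_left]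
  exact ((ψ (P s)).2.norm_coe_le_norm t).trans_lt hs3

end Expansion

theorem theorem1 (S : PlanarSystem) (A₀ : ℝ) (hA₀ : A₀ ∈ S.W)
    (p : ℤ) (q : ℕ) (hq : 0 < q) (hpq : IsCoprime p (q : ℤ))
    (hω : S.ω A₀ = (p : ℝ) / (q : ℝ)) (hω' : deriv S.ω A₀ ≠ 0)
    (t₀ : ℝ) (n : ℕ) (hn : Odd n) (hM : IsZeroOfOrder (S.melnikov A₀ q) n t₀) :
    ∃ ε₀ : ℝ, 0 < ε₀ ∧ ∃ α A : ℝ → ℝ → ℝ,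
      S.IsSubharmonic A₀ p q t₀ ε₀ α A ∧
      ∀ σ : ℝ, σ = 1 ∨ σ = -1 →
        HasFractionalExpansion n.factorial (2 * Real.pi * q) {ε | |ε| < ε₀ ∧ 0 ≤ σ * ε}
          (fun ε t => α ε t - S.ω A₀ * t) ∧
        HasFractionalExpansion n.factorial (2 * Real.pi * q) {ε | |ε| < ε₀ ∧ 0 ≤ σ * ε}
          (fun ε t => A ε t - A₀) := by
  have hq' : (0 : ℝ) < q := by exact_mod_cast hq
  have hT : 0 < 2 * Real.pi * q := by positivity
  have hres : S.ω A₀ * (2 * Real.pi * q) = 2 * Real.pi * p := by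
    rw [hω]
    field_simp
  choose X hX hX0 hXsol using
    PlanarSystem.exists_subharmonic_branch (S := S) hA₀ hT hres hω' hn hM
  set N := n.factorial
  have hN : N ≠ 0 := Nat.factorial_ne_zero n
  have hX1 : ∀ σ, AnalyticAt ℝ (fun s => (X σ s).1) 0 := fun σ => analyticAt_fst.comp (hX σ)
  have hX2 : ∀ σ, AnalyticAt ℝ (fun s => (X σ s).2) 0 := fun σ => analyticAt_snd.comp (hX σ)
  choose r₁ hr₁ C₁ c₁ hc₁ hC₁ hsum₁ using fun σ =>
    (hX1 σ).exists_hasSum_pow_smul (by simp [hX0 σ])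
  choose r₂ hr₂ C₂ c₂ hc₂ hC₂ hsum₂ using fun σ =>
    (hX2 σ).exists_hasSum_pow_smul (by simp [hX0 σ])
  choose δ hδ hball using fun σ => Metric.eventually_nhds_iff.1 (hXsol σ)
  -- a common range of the parameter `s` for both signs of `ε`
  obtain ⟨ρ, hρ, hρle⟩ : ∃ ρ > (0 : ℝ), ∀ σ : ℝ, σ = 1 ∨ σ = -1 →
      ρ ≤ r₁ σ ∧ ρ ≤ r₂ σ ∧ ρ ≤ δ σ := by
    refine ⟨min (min (r₁ 1) (min (r₂ 1) (δ 1))) (min (r₁ (-1)) (min (r₂ (-1)) (δ (-1)))), ?_, ?_⟩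
    · simp [hr₁, hr₂, hδ]
    · rintro σ (rfl | rfl) <;> simp
  let root : ℝ → ℝ := fun ε => |ε| ^ (1 / (N : ℝ))
  have hroot0 : ∀ ε, 0 ≤ root ε := fun ε => by positivity
  have hrootpow : ∀ ε, root ε ^ N = |ε| := fun ε => by
    simp only [root, one_div]
    exact Real.rpow_inv_natCast_pow (abs_nonneg ε) hN
  have hrootlt : ∀ ε, |ε| < ρ ^ N → root ε < ρ := fun ε hε =>
    lt_of_pow_lt_pow_left₀ N hρ.le (by rwa [hrootpow])
  have hroottend : Tendsto root (𝓝 0) (𝓝 0) := by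
    have h1 : ContinuousAt root 0 :=
      (continuous_abs.continuousAt).rpow_const (Or.inr (by positivity))
    have h2 : root 0 = 0 := by
      simp [root, hN]
    simpa [ContinuousAt, h2] using h1
  let Z : ℝ → C(Set.Icc 0 (2 * Real.pi * q), ℝ) × C(Set.Icc 0 (2 * Real.pi * q), ℝ) :=
    fun ε => if 0 ≤ ε then X 1 (root ε) else X (-1) (root ε)
  -- at `ε = 0` both branches start from the unperturbed trajectory
  have hZ : ∀ σ : ℝ, σ = 1 ∨ σ = -1 → ∀ ε, 0 ≤ σ * ε → Z ε = X σ (root ε) := by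
    rintro σ (rfl | rfl) ε hε
    · rw [one_mul] at hε
      simp [Z, hε]
    · rcases eq_or_ne ε 0 with rfl | h0
      · have h2 : root 0 = 0 := by
          simp [root, hN]
        simp [Z, h2, hX0]
      · have : ¬ 0 ≤ ε := fun h => h0 (le_antisymm (by linarith) h)
        simp [Z, this]
  have hsign : ∀ ε : ℝ, ∃ σ : ℝ, (σ = 1 ∨ σ = -1) ∧ 0 ≤ σ * ε ∧ σ * |ε| = ε := fun ε => by
    rcases le_total 0 ε with h | h
    · exact ⟨1, Or.inl rfl, by linarith, by rw [abs_of_nonneg h, one_mul]⟩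
    · exact ⟨-1, Or.inr rfl, by linarith, by rw [abs_of_nonpos h]; ring⟩
  have hZtend : Tendsto (fun ε => ‖Z ε‖) (𝓝 0) (𝓝 0) := by
    have h1 : ∀ σ, Tendsto (fun ε => ‖X σ (root ε)‖) (𝓝 0) (𝓝 0) := fun σ => by
      have := ((hX σ).continuousAt.norm).tendsto
      rw [hX0 σ, norm_zero] at this
      exact this.comp hroottend
    refine squeeze_zero (g := fun ε => ‖X 1 (root ε)‖ + ‖X (-1) (root ε)‖)
      (fun ε => norm_nonneg _) (fun ε => ?_) (by simpa using (h1 1).add (h1 (-1)))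
    simp only [Z]
    split_ifs
    · exact le_add_of_nonneg_right (norm_nonneg _)
    · exact le_add_of_nonneg_left (norm_nonneg _)
  refine ⟨ρ ^ N, by positivity, fun ε t => S.ω A₀ * t + periodicExt hT (Z ε).1 t,
    fun ε t => A₀ + periodicExt hT (Z ε).2 t, ⟨fun ε hε => ?_, fun ε _ t => ?_, fun ε _ t => ?_,
      ?_, ?_⟩, fun σ hσ => ⟨?_, ?_⟩⟩
  · obtain ⟨σ, hσ, hσε, hσε'⟩ := hsign ε
    have h1 := hball σ (y := root ε) (by
      rw [Real.dist_eq, sub_zero, abs_of_nonneg (hroot0 ε)]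
      exact (hrootlt ε hε).trans_le (hρle σ hσ).2.2)
    rw [hrootpow, hσε', ← hZ σ hσ ε hσε] at h1
    exact h1
  · rw [periodicExt_periodic hT, mul_add, hres]
    ring
  · rw [periodicExt_periodic hT]
  · rw [Metric.tendstoUniformly_iff]
    intro η hη
    filter_upwards [hZtend.eventually_lt_const hη] with ε hε t
    rw [dist_comm, Real.dist_eq, add_sub_cancel_left]
    exact ((abs_periodicExt_le hT _ t).trans (norm_fst_le _)).trans_lt hε
  · rw [Metric.tendstoUniformly_iff]
    intro η hη
    filter_upwards [hZtend.eventually_lt_const hη] with ε hε t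
    rw [dist_comm, Real.dist_eq, add_sub_cancel_left]
    exact ((abs_periodicExt_le hT _ t).trans (norm_snd_le _)).trans_lt hε
  · refine hasFractionalExpansion_periodicExt hT (hr₁ σ) (hc₁ σ) (hC₁ σ) (hsum₁ σ)
      (fun ε hε => (hrootlt ε hε.1).trans_le (hρle σ hσ).1) fun ε hε t => ?_
    rw [add_sub_cancel_left, hZ σ hσ ε hε.2]
  · refine hasFractionalExpansion_periodicExt hT (hr₂ σ) (hc₂ σ) (hC₂ σ) (hsum₂ σ)
      (fun ε hε => (hrootlt ε hε.1).trans_le (hρle σ hσ).2.1) fun ε hε t => ?_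
    rw [add_sub_cancel_left, hZ σ hσ ε hε.2]
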